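/- Let $T$ be a finite tree whose vertex set $\mathbf V$, with $\nu$ elements, is partitioned into a set $\mathbf V^-$ of negative and a set $\mathbf V^+$ of positive vertices. For $p,q\in\mathbf V$ let $[p,q]$ be the vertex set of the path of $T$ from $p$ to $q$. A signed building block of $T$ is a subset $B\subseteq\mathbf V$ such that $[p,q]\cap\mathbf V^-\subseteq B$ for all $p,q\in B$ and $[p,q]\cap\mathbf V^+\subseteq\mathbf V\setminus B$ for all $p,q\in\mathbf V\setminus B$. The signed tree associahedron is $$\mathrm{Asso}(T)=\Big\{x\in\mathbb R^{\mathbf V}\;:\;\sum_{v\in\mathbf V}x_v=\tbinom{\nu+1}{2},\ \sum_{v\in B}x_v\ge\tbinom{|B|+1}{2}\text{ for every signed building block }B\Big\}.$$ For $\emptyset\ne V\subseteq\mathbf V$ let $\Delta_V=\mathrm{conv}\{e_v : v\in V\}$. A negative path with endpoints $p,q$ is a set $P\subseteq[p,q]$ that contains $p$, $q$ and all negative vertices of $[p,q]$; here $p=q$ is allowed, and then $P=\{p\}$. Write $P^+=P\cap\mathbf V^+$. The weight of $P$ is $$\Omega(P)=\begin{cases}(-1)^{|P^+|}\,\omega(p,q)\,\omega(q,p)&\text{if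 }p\ne q,\\(-1)^{|P^+|}\,\tilde\omega(p)&\text{if }p=q,\end{cases}$$ where * for $p\in\mathbf V^+$, $\omega(p,q)$ is $1$ plus the sum of the cardinalities of the connected components of $T\setminus\{p\}$ not containing $q$, and for $p\in\mathbf V^-$, $\omega(p,q)=-1$; * for $p\in\mathbf V^+$, $\tilde\omega(p)=\frac12\sum_C(1+|C|)(1+|C'|)$, where $C$ ranges over the connected components of $T\setminus\{p\}$ and $C'$ is the union of the components other than $C$ (so that $|C'|=\nu-1-|C|$), and for $p\in\mathbf V^-$, $\tilde\omega(p)=1$. Then there is a unique family of real numbers $(y_V(T))_{V\subseteq\mathbf V}$ with $y_\emptyset(T)=0$ such that $\mathrm{Asso}(T)=\sum_{\emptyset\ne V\subseteq\mathbf V}y_V(T)\,\Delta_V$ as a Minkowski sum and difference, that is, $$\mathrm{Asso}(T)+\sum_{y_V(T)<0}(-y_V(T))\,\Delta_V=\sum_{y_V(T)>0}y_V(T)\,\Delta_V ,$$ the sums running over nonempty $V$, and it is given for all $V\subseteq\mathbf V$ by $$y_V(T)=\begin{cases}0&\text{if }V\text{ is not a negative path},\\ \Omega(V)+\dfrac{\nu\cdot\deg_T(v)}{2}+1&\text{if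 }V=\{v\}\text{ with }v\in\mathbf V^+,\\ \Omega(V)&\text{otherwise.}\end{cases}$$ -/

import Mathlib

open scoped Pointwise

namespace SignedTree

variable {V : Type*} [Fintype V] [DecidableEq V]

/-- The vertex set of the path `[p, q]` of a tree `T`: the vertices lying on the (unique)
path of `T` from `p` to `q`. -/
def pathSet (T : SimpleGraph V) (p q : V) : Set V :=
  {w | ∃ γ : T.Walk p q, γ.IsPath ∧ w ∈ γ.support}

/-- `B` is convex in `T` with respect to `S`: any vertex of `S` lying on the path of `T` between
two vertices of `B` is also in `B`. -/
def ConvexFor (T : SimpleGraph V) (S B : Finset V) : Prop :=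
  ∀ p ∈ B, ∀ q ∈ B, ∀ w ∈ S, w ∈ pathSet T p q → w ∈ B

/-- A signed building block of the signed tree `T` with set of positive vertices `pos` (the
negative vertices being those of `posᶜ`): a negative convex set with positive convex complement. -/
def IsSignedBuildingBlock (T : SimpleGraph V) (pos B : Finset V) : Prop :=
  ConvexFor T posᶜ B ∧ ConvexFor T pos Bᶜ

/-- The signed tree associahedron `Asso(T)`: the intersection of the hyperplane
`∑ v, x v = (ν + 1).choose 2` with the half-spaces `∑ v ∈ B, x v ≥ (|B| + 1).choose 2` for all
signed building blocks `B`. -/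
def asso (T : SimpleGraph V) (pos : Finset V) : Set (V → ℝ) :=
  {x | ∑ v, x v = ((Fintype.card V + 1).choose 2 : ℝ) ∧
    ∀ B : Finset V, IsSignedBuildingBlock T pos B → ((B.card + 1).choose 2 : ℝ) ≤ ∑ v ∈ B, x v}

/-- The face `Δ_U = conv {e_v | v ∈ U}` of the standard simplex of `ℝ^V`. -/
def simplexFace (U : Finset V) : Set (V → ℝ) :=
  convexHull ℝ ((fun v : V => (Pi.single v 1 : V → ℝ)) '' (U : Set V))

/-- `P` is the Minkowski sum and difference `∑ y_U • Δ_U` over the nonempty subsets `U` of `V`: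
`P` plus the Minkowski sum of the `(-y_U) • Δ_U` with `y_U < 0` is the Minkowski sum of the
`y_U • Δ_U` with `y_U > 0`. The empty set does not contribute, and `y_∅ = 0` by convention. -/
def IsMinkowskiDecomposition (P : Set (V → ℝ)) (y : Finset V → ℝ) : Prop :=
  y ∅ = 0 ∧
    P + ∑ U : Finset V with U.Nonempty ∧ y U < 0, (-y U) • simplexFace U =
      ∑ U : Finset V with U.Nonempty ∧ 0 < y U, y U • simplexFace U

/-- `P` is a negative path with endpoints `p` and `q`: it contains `p` and `q`, and consists of all
negative and some positive vertices of the path `[p, q]`. -/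
def IsNegativePathBetween (T : SimpleGraph V) (pos : Finset V) (p q : V) (P : Finset V) : Prop :=
  p ∈ P ∧ q ∈ P ∧ (∀ w ∈ P, w ∈ pathSet T p q) ∧ ∀ w ∈ pathSet T p q, w ∉ pos → w ∈ P

/-- `P` is a negative path, i.e. a negative path between some endpoints. -/
def IsNegativePath (T : SimpleGraph V) (pos P : Finset V) : Prop :=
  ∃ p q : V, IsNegativePathBetween T pos p q P

/-- The type of connected components of `T ∖ {p}`. -/
abbrev Branch (T : SimpleGraph V) (p : V) : Type _ :=
  (T.induce ({p}ᶜ : Set V)).ConnectedComponent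

/-- The vertex set, inside `V`, of a connected component of `T ∖ {p}`. -/
def Branch.verts {T : SimpleGraph V} {p : V} (C : Branch T p) : Set V :=
  Subtype.val '' C.supp

open Classical in
/-- `ω(p, q)`: for `p` positive, `1` plus the sum of the cardinalities of the connected components
of `T ∖ {p}` not containing `q`; for `p` negative, `-1`. -/
noncomputable def omega (T : SimpleGraph V) (pos : Finset V) (p q : V) : ℝ :=
  if p ∈ pos then 1 + ∑ C : Branch T p with q ∉ C.verts, (C.verts.ncard : ℝ) else -1

open Classical in
/-- `ω̃(p)`: for `p` positive, half of the sum, over the connected components `C` of `T ∖ {p}`, of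
`(1 + |C|) (1 + |C'|)`, where `C'` is the union of the other components; for `p` negative, `1`. -/
noncomputable def omegaTilde (T : SimpleGraph V) (pos : Finset V) (p : V) : ℝ :=
  if p ∈ pos then
    (∑ C : Branch T p, (1 + (C.verts.ncard : ℝ)) *
      (1 + ∑ C' : Branch T p with C' ≠ C, (C'.verts.ncard : ℝ))) / 2
  else 1

/-- The weight `Ω(P)` of a negative path `P` with endpoints `p` and `q`. -/
noncomputable def weight (T : SimpleGraph V) (pos : Finset V) (p q : V) (P : Finset V) : ℝ :=
  (-1) ^ (P ∩ pos).card *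
    (if p = q then omegaTilde T pos p else omega T pos p q * omega T pos q p)

end SignedTree

namespace SignedTree

variable {V : Type*} {T : SimpleGraph V}

/-! ### Betweenness in a tree -/

/-! Summing the claimed $y_U$ over all $U \subseteq R$ gives a set function $g(R)$, half of
`twiceRank`. Negative paths in $R$ with fixed distinct endpoints differ only in their inner positive
vertices, and their weights alternate in sign. They cancel unless `Sees` holds, when one product of
shadow sizes remains (`sum_weight_negativePaths`).

It then suffices that $g$ is supermodular and that $\mathrm{Asso}(T)$ is its base polytope $\{x(R)
\ge g(R),\ x(\mathbf V) = g(\mathbf V)\}$. For such a polytope the greedy algorithm gives the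
minimum in direction $w$ as $\sum_U y_U \min_U w$, and Hahn–Banach turns equality of support
functions into the Minkowski identity. Uniqueness is Möbius inversion: the direction $1_R$ recovers
$\sum_{U \subseteq R} y_U$.

To control $g$, write `twiceRank` as $2|R|$ plus a sum of `pairRank` over ordered pairs $(u,v)$, and
read the path from $u$ to $v \ne u$ with one bit of memory (`LastStop`). The bit starts as $[u \in
R]$; a positive vertex in $R$ sets it, a negative vertex outside $R$ clears it, all others keep it.
`pairRank` is the final bit (counted only if $v \in R$) minus the number of changes from 0 to 1
(`deficit`). Supermodularity becomes an invariant checked vertex by vertex. On a building block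
every pair of distinct elements contributes 1 and every other pair 0, so $g(B) = \binom{|B|+1}{2}$.
A set that is not a block is cut at the vertex violating convexity, where $g$ is modular, so its
inequality follows from those of blocks. -/

theorem mem_pathSet_iff_forall_walk (hT : T.IsTree) {p q w : V} :
    w ∈ pathSet T p q ↔ ∀ γ : T.Walk p q, w ∈ γ.support := by
  classical
  constructor
  · rintro ⟨γ, hγ, hw⟩ δ
    have : γ = δ.bypass := (hT.existsUnique_path p q).unique hγ δ.bypass_isPath
    exact δ.support_bypass_subset_support (this ▸ hw)
  · intro h
    obtain ⟨γ, hγ, -⟩ := hT.existsUnique_path p q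
    exact ⟨γ, hγ, h γ⟩

/-- In a tree the unique path is a geodesic. Betweenness thereby becomes linear arithmetic with
triangle inequalities, which `omega` can finish. -/
theorem mem_pathSet_iff_dist (hT : T.IsTree) {p q w : V} :
    w ∈ pathSet T p q ↔ T.dist p w + T.dist w q = T.dist p q := by
  classical
  constructor
  · rintro ⟨γ, hγ, hw⟩
    obtain ⟨δ, hδ, hl⟩ := hT.connected.exists_path_of_dist p q
    obtain rfl := (hT.existsUnique_path p q).unique hγ hδ
    refine le_antisymm ?_ hT.connected.dist_triangle
    have := congrArg SimpleGraph.Walk.length (γ.take_spec hw)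
    rw [SimpleGraph.Walk.length_append] at this
    rw [← hl, ← this]
    exact Nat.add_le_add (SimpleGraph.dist_le _) (SimpleGraph.dist_le _)
  · intro h
    obtain ⟨γ, hγ⟩ := hT.connected.exists_walk_length_eq_dist p w
    obtain ⟨δ, hδ⟩ := hT.connected.exists_walk_length_eq_dist w q
    refine ⟨γ.append δ, SimpleGraph.Walk.isPath_of_length_eq_dist _ ?_, ?_⟩
    · rw [SimpleGraph.Walk.length_append, hγ, hδ, h]
    · simp

theorem pathSet_comm (hT : T.IsTree) (p q : V) : pathSet T p q = pathSet T q p := by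
  ext w
  simp only [mem_pathSet_iff_dist hT, T.dist_comm (u := p), T.dist_comm (v := q)]
  rw [T.dist_comm (u := q) (v := p), add_comm]

theorem left_mem_pathSet (hT : T.IsTree) (p q : V) : p ∈ pathSet T p q := by
  simp [mem_pathSet_iff_dist hT]

theorem right_mem_pathSet (hT : T.IsTree) (p q : V) : q ∈ pathSet T p q := by
  simp [mem_pathSet_iff_dist hT]

theorem mem_pathSet_self (hT : T.IsTree) {p w : V} : w ∈ pathSet T p p ↔ w = p := by
  rw [mem_pathSet_iff_dist hT]
  constructor
  · intro h
    rw [T.dist_self] at h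
    exact (hT.connected.dist_eq_zero_iff.1 (by omega : T.dist w p = 0))
  · rintro rfl; simp

theorem pathSet_subset_union (hT : T.IsTree) {x z w : V} (y : V) (h : w ∈ pathSet T x z) :
    w ∈ pathSet T x y ∨ w ∈ pathSet T y z := by
  by_contra! hn
  simp only [mem_pathSet_iff_forall_walk hT, not_forall] at hn
  obtain ⟨⟨γ, hγ⟩, δ, hδ⟩ := hn
  have := (mem_pathSet_iff_forall_walk hT).1 h (γ.append δ)
  rw [SimpleGraph.Walk.mem_support_append_iff] at this
  tauto

theorem eq_of_mem_pathSet (hT : T.IsTree) {u v w : V} (h : w ∈ pathSet T u v)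
    (h' : v ∈ pathSet T u w) : w = v := by
  rw [mem_pathSet_iff_dist hT] at h h'
  exact hT.connected.dist_eq_zero_iff.1 (by omega : T.dist w v = 0)

theorem pathSet_trans (hT : T.IsTree) {u v w z : V} (h : w ∈ pathSet T u v)
    (h' : z ∈ pathSet T u w) : z ∈ pathSet T u v := by
  rw [mem_pathSet_iff_dist hT] at *
  have := hT.connected.dist_triangle (u := u) (v := z) (w := v)
  have := hT.connected.dist_triangle (u := z) (v := w) (w := v)
  omega

/-- If `p` lies between `u` and `q`, then `q` lies between `p` and `v` if and only if
it lies between `u` and `v`. -/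
theorem mem_pathSet_iff_of_mem (hT : T.IsTree) {u p q v : V} (hpq : p ≠ q)
    (h : p ∈ pathSet T u q) : q ∈ pathSet T p v ↔ q ∈ pathSet T u v := by
  constructor
  · intro hq
    rcases pathSet_subset_union hT u hq with h' | h'
    · rw [pathSet_comm hT] at h'
      exact absurd (eq_of_mem_pathSet hT h h') hpq
    · exact h'
  · intro hq
    rw [mem_pathSet_iff_dist hT] at *
    have := hT.connected.dist_triangle (u := u) (v := p) (w := v)
    have := hT.connected.dist_triangle (u := p) (v := q) (w := v)
    omega

theorem mem_pathSet_of_mem_of_mem (hT : T.IsTree) {u p q v : V} (h : p ∈ pathSet T u q)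
    (h' : q ∈ pathSet T u v) : q ∈ pathSet T p v := by
  rw [mem_pathSet_iff_dist hT] at *
  have := hT.connected.dist_triangle (u := u) (v := p) (w := v)
  have := hT.connected.dist_triangle (u := p) (v := q) (w := v)
  omega

theorem mem_pathSet_adj (hT : T.IsTree) {u v w : V} (h : T.Adj u v) :
    w ∈ pathSet T u v ↔ w = u ∨ w = v := by
  constructor
  · intro hw
    have := (mem_pathSet_iff_forall_walk hT).1 hw h.toWalk
    simpa using this
  · rintro (rfl | rfl)
    exacts [left_mem_pathSet hT _ _, right_mem_pathSet hT _ _]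

theorem mem_pathSet_step (hT : T.IsTree) {u v w z : V} (hvw : T.Adj v w)
    (hv : v ∈ pathSet T u w) : z ∈ pathSet T u w ↔ z ∈ pathSet T u v ∨ z = w := by
  constructor
  · intro hz
    rcases pathSet_subset_union hT v hz with h | h
    · exact Or.inl h
    · rcases (mem_pathSet_adj hT hvw).1 h with rfl | rfl
      exacts [Or.inl (right_mem_pathSet hT _ _), Or.inr rfl]
  · rintro (h | rfl)
    exacts [pathSet_trans hT hv h, right_mem_pathSet hT _ _]

theorem not_mem_pathSet_step (hT : T.IsTree) {u v w : V} (hvw : T.Adj v w)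
    (hv : v ∈ pathSet T u w) : w ∉ pathSet T u v :=
  fun h => hvw.ne (eq_of_mem_pathSet hT hv h)

theorem exists_adj_mem_pathSet (hT : T.IsTree) {u w : V} (h : u ≠ w) :
    ∃ v, T.Adj v w ∧ v ∈ pathSet T u w := by
  obtain ⟨γ, hγ, -⟩ := hT.existsUnique_path u w
  exact ⟨γ.penultimate, γ.adj_penultimate (SimpleGraph.Walk.not_nil_of_ne h),
    γ, hγ, γ.getVert_mem_support _⟩

/-- Induction along the paths that start in a given vertex of a tree. -/
theorem path_induction (hT : T.IsTree) (u : V) {P : V → Prop} (base : ∀ v, T.Adj u v → P v)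
    (step : ∀ v w, v ≠ u → u ≠ w → T.Adj v w → v ∈ pathSet T u w → P v → P w) :
    ∀ w, u ≠ w → P w := by
  have key : ∀ n w, T.dist u w = n → u ≠ w → P w := by
    intro n
    induction n with
    | zero => exact fun w h hw => absurd (hT.connected.dist_eq_zero_iff.1 h) hw
    | succ n ih =>
      intro w h hw
      obtain ⟨v, hvw, hv⟩ := exists_adj_mem_pathSet hT hw
      by_cases hvu : v = u
      · exact base w (hvu ▸ hvw)
      · refine step v w hvu hw hvw hv (ih v ?_ (Ne.symm hvu))
        rw [mem_pathSet_iff_dist hT, SimpleGraph.dist_eq_one_iff_adj.2 hvw] at hv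
        omega
  exact fun w => key _ w rfl

/-- The vertices different from `w` are partitioned by the relation of not being separated
by `w`. -/
theorem not_mem_pathSet_trans (hT : T.IsTree) {w x y z : V} (h : w ∉ pathSet T x y)
    (h' : w ∉ pathSet T y z) : w ∉ pathSet T x z :=
  fun hw => (pathSet_subset_union hT y hw).elim h h'

theorem reachable_induce_iff (hT : T.IsTree) {p : V} (u v : ({p}ᶜ : Set V)) :
    (T.induce ({p}ᶜ : Set V)).Reachable u v ↔ p ∉ pathSet T u v := by
  constructor
  · rintro ⟨γ⟩ h
    have := (mem_pathSet_iff_forall_walk hT).1 h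
      (γ.map (SimpleGraph.Embedding.induce ({p}ᶜ : Set V)).toHom)
    erw [SimpleGraph.Walk.support_map, List.mem_map] at this
    obtain ⟨x, -, hx⟩ := this
    exact x.2 hx
  · intro h
    rw [mem_pathSet_iff_forall_walk hT, not_forall] at h
    obtain ⟨γ, hγ⟩ := h
    exact ⟨γ.induce _ fun x hx => by rintro rfl; exact hγ hx⟩

end SignedTree

namespace SignedTree

set_option linter.unusedSectionVars false

open scoped Classical

variable {V : Type*} [Fintype V] [DecidableEq V] {T : SimpleGraph V}

/-! ### The rank function of the signed tree associahedron -/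

/-- `p` and `q` are distinct elements of `R`, and on the open path between them all negative
vertices and no positive vertex belong to `R`. -/
def Sees (T : SimpleGraph V) (pos R : Finset V) (p q : V) : Prop :=
  p ∈ R ∧ q ∈ R ∧ p ≠ q ∧ ∀ z ∈ pathSet T p q, z ≠ p → z ≠ q → (z ∈ pos ↔ z ∉ R)

/-- The vertices represented by `p` when looking from `q`: only `p` if `p` is negative, and all
the vertices hidden from `q` by `p` if `p` is positive. -/
noncomputable def shadow (T : SimpleGraph V) (pos : Finset V) (p q : V) : Finset V :=
  {u | u = p ∨ (p ∈ pos ∧ p ∈ pathSet T u q)}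

/-- The number of ordered pairs of vertices strictly separated by `p`. -/
noncomputable def numSeparated (T : SimpleGraph V) (p : V) : ℤ :=
  ∑ u, ∑ v, if p ∈ pathSet T u v ∧ p ≠ u ∧ p ≠ v then 1 else 0

/-- Twice the minimum on the signed tree associahedron of the sum of the coordinates in `R`. -/
noncomputable def twiceRank (T : SimpleGraph V) (pos R : Finset V) : ℤ :=
  (∑ p, ∑ q, if Sees T pos R p q then
    ((shadow T pos p q).card : ℤ) * ((shadow T pos q p).card : ℤ) else 0) +
  ∑ p ∈ R, (2 - if p ∈ pos then numSeparated T p else 0)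

/-- The contribution of an ordered pair of vertices to `twiceRank`. -/
noncomputable def pairRank (T : SimpleGraph V) (pos R : Finset V) (u v : V) : ℤ :=
  (∑ q, ∑ p, if Sees T pos R p q ∧ u ∈ shadow T pos p q ∧ v ∈ shadow T pos q p then 1 else 0) -
  ∑ q, if q ∈ R ∧ q ∈ pos ∧ q ∈ pathSet T u v ∧ q ≠ u ∧ q ≠ v then 1 else 0

/-- A product of shadow sizes counts pairs $(u,v)$ hidden behind $p$ and $q$, and `numSeparated`
also counts pairs; it remains to interchange the sums. -/
theorem twiceRank_eq_sum_pairRank (pos R : Finset V) :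
    twiceRank T pos R = (∑ u, ∑ v, pairRank T pos R u v) + 2 * (R.card : ℤ) := by
  have h1 : ∀ p q, (if Sees T pos R p q then
      ((shadow T pos p q).card : ℤ) * ((shadow T pos q p).card : ℤ) else 0) =
      ∑ u, ∑ v, if Sees T pos R p q ∧ u ∈ shadow T pos p q ∧ v ∈ shadow T pos q p
        then (1 : ℤ) else 0 := by
    intro p q
    have hc : ∀ s : Finset V, (s.card : ℤ) = ∑ u, if u ∈ s then 1 else 0 := by simp
    split_ifs with h
    · rw [hc, hc, Finset.sum_mul_sum]
      refine Finset.sum_congr rfl fun u _ => Finset.sum_congr rfl fun v _ => ?_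
      by_cases hu : u ∈ shadow T pos p q <;> by_cases hv : v ∈ shadow T pos q p <;> simp [h, hu, hv]
    · simp [h]
  have h2 : ∑ p ∈ R, (2 - if p ∈ pos then numSeparated T p else 0) =
      2 * (R.card : ℤ) - ∑ u, ∑ v, ∑ q,
        if q ∈ R ∧ q ∈ pos ∧ q ∈ pathSet T u v ∧ q ≠ u ∧ q ≠ v then (1 : ℤ) else 0 := by
    rw [Finset.sum_sub_distrib, Finset.sum_const, nsmul_eq_mul, mul_comm]
    congr 1
    have h3 : ∀ f : V → V → V → ℤ, ∑ u, ∑ v, ∑ q, f u v q = ∑ q, ∑ u, ∑ v, f u v q := by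
      intro f
      simp_rw [Finset.sum_comm (s := Finset.univ) (t := Finset.univ) (f := fun v q => f _ v q)]
      exact Finset.sum_comm
    rw [h3, ← Finset.sum_filter_add_sum_filter_not Finset.univ (· ∈ R), Finset.filter_mem_eq_inter,
      Finset.univ_inter, Finset.sum_eq_zero (s := Finset.filter _ _), add_zero]
    · refine Finset.sum_congr rfl fun q hq => ?_
      by_cases hp : q ∈ pos <;> simp [hp, hq, numSeparated]
    · intro q hq
      simp [(Finset.mem_filter.1 hq).2]
  rw [twiceRank, h2]
  simp_rw [h1, pairRank, Finset.sum_sub_distrib]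
  have h3 : ∀ f : V → V → V → V → ℤ,
      ∑ p, ∑ q, ∑ u, ∑ v, f p q u v = ∑ u, ∑ v, ∑ q, ∑ p, f p q u v := by
    intro f
    simp_rw [← Fintype.sum_prod_type']
    refine Fintype.sum_equiv ⟨fun x => ⟨x.2.2.1, x.2.2.2, x.2.1, x.1⟩,
      fun x => ⟨x.2.2.2, x.2.2.1, x.1, x.2.1⟩, fun _ => rfl, fun _ => rfl⟩ _ _ fun x => rfl
  rw [h3]
  ring

theorem Sees.symm (hT : T.IsTree) {pos R : Finset V} {p q : V} (h : Sees T pos R p q) :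
    Sees T pos R q p :=
  ⟨h.2.1, h.1, h.2.2.1.symm, fun z hz hq hp => h.2.2.2 z (pathSet_comm hT p q ▸ hz) hp hq⟩

theorem sees_comm (hT : T.IsTree) {pos R : Finset V} {p q : V} :
    Sees T pos R p q ↔ Sees T pos R q p := ⟨Sees.symm hT, Sees.symm hT⟩

theorem pairRank_comm (hT : T.IsTree) (pos R : Finset V) (u v : V) :
    pairRank T pos R u v = pairRank T pos R v u := by
  unfold pairRank
  congr 1
  · rw [Finset.sum_comm]
    refine Finset.sum_congr rfl fun q _ => Finset.sum_congr rfl fun p _ => ?_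
    rw [sees_comm hT]
    congr 1
    ext; tauto
  · refine Finset.sum_congr rfl fun q _ => ?_
    rw [pathSet_comm hT]
    congr 1
    ext; tauto

/-- The last vertex before `q` on the path from `u` to `q` that stops a walk belongs to `R`,
where a walk is stopped by `u`, the positive vertices in `R` and the negative ones not in `R`. -/
def LastStop (T : SimpleGraph V) (pos R : Finset V) (u q : V) : Prop :=
  ∃ p ∈ pathSet T u q, p ≠ q ∧ p ∈ R ∧ (p = u ∨ p ∈ pos) ∧
    ∀ z ∈ pathSet T p q, z ≠ p → z ≠ q → (z ∈ pos ↔ z ∉ R)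

/-- The number of positive vertices of `R` on the open path from `u` to `v` at which the
preceding stop does not belong to `R`. -/
noncomputable def deficit (T : SimpleGraph V) (pos R : Finset V) (u v : V) : ℤ :=
  ∑ q, if q ∈ R ∧ q ∈ pos ∧ q ∈ pathSet T u v ∧ q ≠ u ∧ q ≠ v ∧ ¬ LastStop T pos R u q
    then 1 else 0

theorem lastStop_self (hT : T.IsTree) (pos R : Finset V) (u : V) : ¬ LastStop T pos R u u := by
  rintro ⟨p, hp, hne, -⟩
  exact hne ((mem_pathSet_self hT).1 hp)

theorem mem_shadow_iff (hT : T.IsTree) {pos : Finset V} {p q u : V} :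
    u ∈ shadow T pos p q ↔ p ∈ pathSet T u q ∧ (p = u ∨ p ∈ pos) := by
  simp only [shadow, Finset.mem_filter, Finset.mem_univ, true_and]
  constructor
  · rintro (rfl | h)
    exacts [⟨left_mem_pathSet hT _ _, Or.inl rfl⟩, ⟨h.2, Or.inr h.1⟩]
  · rintro ⟨h, rfl | h'⟩
    exacts [Or.inl rfl, Or.inr ⟨h', h⟩]

/-- No stop lies strictly between $p'$ and $q$, so the stop $p$ cannot come after $p'$. Used in both
directions, this makes the last stop unique. -/
theorem lastStop_unique (hT : T.IsTree) {pos R : Finset V} {u p p' q : V}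
    (hp : p ∈ pathSet T u q) (hpq : p ≠ q) (hpR : p ∈ R) (hpu : p = u ∨ p ∈ pos)
    (hp' : p' ∈ pathSet T u q)
    (h : ∀ z ∈ pathSet T p' q, z ≠ p' → z ≠ q → (z ∈ pos ↔ z ∉ R)) :
    p ∈ pathSet T u p' := by
  rcases pathSet_subset_union hT p' hp with h1 | h1
  · exact h1
  · by_cases hpp : p = p'
    · exact hpp ▸ right_mem_pathSet hT _ _
    · rcases hpu with rfl | hpos
      · exact left_mem_pathSet hT _ _
      · exact absurd hpR ((h p h1 hpp hpq).1 hpos)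

theorem sum_sees_eq (hT : T.IsTree) (pos R : Finset V) (u v q : V) :
    (∑ p, if Sees T pos R p q ∧ u ∈ shadow T pos p q ∧ v ∈ shadow T pos q p then (1 : ℤ) else 0) =
      if q ∈ R ∧ q ∈ pathSet T u v ∧ (q = v ∨ q ∈ pos) ∧ LastStop T pos R u q then 1 else 0 := by
  have key : ∀ p, (Sees T pos R p q ∧ u ∈ shadow T pos p q ∧ v ∈ shadow T pos q p) ↔
      (q ∈ R ∧ q ∈ pathSet T u v ∧ (q = v ∨ q ∈ pos)) ∧ p ∈ pathSet T u q ∧ p ≠ q ∧ p ∈ R ∧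
        (p = u ∨ p ∈ pos) ∧ ∀ z ∈ pathSet T p q, z ≠ p → z ≠ q → (z ∈ pos ↔ z ∉ R) := by
    intro p
    rw [mem_shadow_iff hT, mem_shadow_iff hT, pathSet_comm hT v p]
    constructor
    · rintro ⟨⟨hp, hq, hne, hz⟩, ⟨h1, h2⟩, h3, h4⟩
      exact ⟨⟨hq, (mem_pathSet_iff_of_mem hT hne h1).1 h3, h4⟩, h1, hne, hp, h2, hz⟩
    · rintro ⟨⟨hq, h3, h4⟩, h1, hne, hp, h2, hz⟩
      exact ⟨⟨hp, hq, hne, hz⟩, ⟨h1, h2⟩, (mem_pathSet_iff_of_mem hT hne h1).2 h3, h4⟩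
  split_ifs with h
  · obtain ⟨hq, h3, h4, p, hp⟩ := h
    rw [Finset.sum_eq_single p]
    · rw [if_pos ((key p).2 ⟨⟨hq, h3, h4⟩, hp⟩)]
    · intro p' _ hne
      rw [if_neg]
      rw [key]
      rintro ⟨-, hp'⟩
      refine hne (eq_of_mem_pathSet hT (u := u) ?_ ?_)
      · exact lastStop_unique hT hp'.1 hp'.2.1 hp'.2.2.1 hp'.2.2.2.1 hp.1 hp.2.2.2.2
      · exact lastStop_unique hT hp.1 hp.2.1 hp.2.2.1 hp.2.2.2.1 hp'.1 hp'.2.2.2.2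
    · simp
  · refine Finset.sum_eq_zero fun p _ => if_neg fun hp => h ?_
    obtain ⟨⟨h1, h2, h3⟩, h4⟩ := (key p).1 hp
    exact ⟨h1, h2, h3, p, h4⟩

/-- For each $q$ at most one $p$ contributes, namely the last stop before $q$. For positive $q \in
R$ inside the path this cancels the subtracted term, unless the last stop is outside $R$. -/
theorem pairRank_eq (hT : T.IsTree) (pos R : Finset V) (u v : V) :
    pairRank T pos R u v =
      (if v ∈ R ∧ LastStop T pos R u v then 1 else 0) - deficit T pos R u v := by
  have hv : (if v ∈ R ∧ LastStop T pos R u v then (1 : ℤ) else 0) =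
      ∑ q, if q = v ∧ v ∈ R ∧ LastStop T pos R u v then (1 : ℤ) else 0 := by
    rw [Finset.sum_eq_single v] <;> simp +contextual
  rw [pairRank, hv, deficit, ← Finset.sum_sub_distrib, ← Finset.sum_sub_distrib]
  refine Finset.sum_congr rfl fun q _ => ?_
  rw [sum_sees_eq hT]
  have hu : q = u → ¬ LastStop T pos R u q := by rintro rfl; exact lastStop_self hT _ _ _
  by_cases hqv : q = v
  · subst hqv
    have := right_mem_pathSet hT u q
    simp [this]
  · by_cases hL : LastStop T pos R u q
    · have : q ≠ u := fun h => hu h hL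
      simp only [hqv, hL]
      simp
      split_ifs <;> simp_all
    · simp [hqv, hL]

theorem pairRank_self (hT : T.IsTree) (pos R : Finset V) (u : V) : pairRank T pos R u u = 0 := by
  rw [pairRank_eq hT, deficit, if_neg fun h => lastStop_self hT _ _ _ h.2, Finset.sum_eq_zero]
  · simp
  · rintro q -
    rw [if_neg]
    rintro ⟨-, -, h, h', -⟩
    exact h' ((mem_pathSet_self hT).1 h)

/-! ### One-step recursions along a path -/

theorem lastStop_adj (hT : T.IsTree) {pos R : Finset V} {u v : V} (h : T.Adj u v) :
    LastStop T pos R u v ↔ u ∈ R := by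
  constructor
  · rintro ⟨p, hp, hne, hR, -⟩
    rcases (mem_pathSet_adj hT h).1 hp with rfl | rfl
    exacts [hR, absurd rfl hne]
  · intro hu
    refine ⟨u, left_mem_pathSet hT _ _, h.ne, hu, Or.inl rfl, fun z hz h1 h2 => ?_⟩
    rcases (mem_pathSet_adj hT h).1 hz with h | h
    exacts [absurd h h1, absurd h h2]

theorem lastStop_step (hT : T.IsTree) {pos R : Finset V} {u v w : V} (hvu : v ≠ u)
    (hvw : T.Adj v w) (hv : v ∈ pathSet T u w) :
    LastStop T pos R u w ↔
      (v ∈ R ∧ v ∈ pos) ∨ (LastStop T pos R u v ∧ (v ∈ pos ↔ v ∉ R)) := by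
  constructor
  · rintro ⟨p, hp, hne, hR, hpu, hz⟩
    have hp' : p ∈ pathSet T u v := ((mem_pathSet_step hT hvw hv).1 hp).resolve_right hne
    have hvp : v ∈ pathSet T p w := mem_pathSet_of_mem_of_mem hT hp' hv
    by_cases hpv : p = v
    · subst hpv
      exact Or.inl ⟨hR, hpu.resolve_left hvu⟩
    · refine Or.inr ⟨⟨p, hp', hpv, hR, hpu, fun z hz1 hz2 hz3 => hz z ?_ hz2 ?_⟩, ?_⟩
      · exact pathSet_trans hT hvp hz1
      · rintro rfl
        exact not_mem_pathSet_step hT hvw hvp hz1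
      · exact hz v hvp (Ne.symm hpv) hvw.ne
  · rintro (⟨h1, h2⟩ | ⟨⟨p, hp, hne, hR, hpu, hz⟩, h⟩)
    · refine ⟨v, hv, hvw.ne, h1, Or.inr h2, fun z hz hz1 hz2 => ?_⟩
      rcases (mem_pathSet_adj hT hvw).1 hz with h | h
      exacts [absurd h hz1, absurd h hz2]
    · have hvp : v ∈ pathSet T p w := mem_pathSet_of_mem_of_mem hT hp hv
      refine ⟨p, pathSet_trans hT hv hp, ?_, hR, hpu, fun z hz1 hz2 hz3 => ?_⟩
      · rintro rfl
        exact not_mem_pathSet_step hT hvw hv hp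
      · by_cases hzv : z = v
        · exact hzv ▸ h
        · exact hz z (((mem_pathSet_step hT hvw hvp).1 hz1).resolve_right hz3) hz2 hzv

theorem deficit_adj (hT : T.IsTree) {pos R : Finset V} {u v : V} (h : T.Adj u v) :
    deficit T pos R u v = 0 := by
  refine Finset.sum_eq_zero fun q _ => if_neg ?_
  rintro ⟨-, -, h1, h2, h3, -⟩
  rcases (mem_pathSet_adj hT h).1 h1 with h | h
  exacts [h2 h, h3 h]

theorem deficit_step (hT : T.IsTree) {pos R : Finset V} {u v w : V} (hvu : v ≠ u)
    (hvw : T.Adj v w) (hv : v ∈ pathSet T u w) :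
    deficit T pos R u w = deficit T pos R u v +
      if v ∈ R ∧ v ∈ pos ∧ ¬ LastStop T pos R u v then 1 else 0 := by
  have h1 : (if v ∈ R ∧ v ∈ pos ∧ ¬ LastStop T pos R u v then (1 : ℤ) else 0) =
      ∑ q, if q = v ∧ v ∈ R ∧ v ∈ pos ∧ ¬ LastStop T pos R u v then (1 : ℤ) else 0 := by
    rw [Finset.sum_eq_single v] <;> simp +contextual
  rw [h1, deficit, deficit, ← Finset.sum_add_distrib]
  refine Finset.sum_congr rfl fun q _ => ?_
  rw [mem_pathSet_step hT hvw hv]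
  have hw := not_mem_pathSet_step hT hvw hv
  by_cases hqv : q = v
  · subst hqv
    simp [right_mem_pathSet hT, hvu, hvw.ne]
  · by_cases hqw : q = w
    · subst hqw
      simp [hw, hqv]
    · simp [hqv, hqw]

/-! ### Values on signed building blocks -/

/-- The bit starts at 1, and by negative convexity the path meets no negative vertex outside $B$
that could clear it. -/
theorem lastStop_of_convexFor (hT : T.IsTree) {pos B : Finset V} (hB : ConvexFor T posᶜ B)
    {u v : V} (hu : u ∈ B) (hv : v ∈ B) (huv : u ≠ v) : LastStop T pos B u v := by
  refine path_induction hT u (P := fun w => w ∈ pathSet T u v → LastStop T pos B u w) ?_ ?_ v huv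
    (right_mem_pathSet hT _ _)
  · exact fun w hw _ => (lastStop_adj hT hw).2 hu
  · intro z w hzu _ hzw hz ih hw
    have hz' := pathSet_trans hT hw hz
    have h1 := ih hz'
    have h2 := hB u hu v hv z
    rw [Finset.mem_compl] at h2
    rw [lastStop_step hT hzu hzw hz]
    tauto

theorem pairRank_block_of_mem (hT : T.IsTree) {pos B : Finset V}
    (hB : IsSignedBuildingBlock T pos B) {u v : V} (hu : u ∈ B) (huv : u ≠ v) :
    pairRank T pos B u v = if v ∈ B then 1 else 0 := by
  rw [pairRank_eq hT, deficit, Finset.sum_eq_zero, sub_zero]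
  · congr 1
    ext
    exact and_iff_left_of_imp fun hv => lastStop_of_convexFor hT hB.1 hu hv huv
  · rintro q -
    rw [if_neg]
    rintro ⟨h1, -, -, h2, -, h3⟩
    exact h3 (lastStop_of_convexFor hT hB.1 hu h1 h2.symm)

theorem pairRank_block (hT : T.IsTree) {pos B : Finset V}
    (hB : IsSignedBuildingBlock T pos B) {u v : V} (huv : u ≠ v) :
    pairRank T pos B u v = if u ∈ B ∧ v ∈ B then 1 else 0 := by
  by_cases hu : u ∈ B
  · simp [pairRank_block_of_mem hT hB hu huv, hu]
  · by_cases hv : v ∈ B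
    · rw [pairRank_comm hT, pairRank_block_of_mem hT hB hv huv.symm]
      simp [hu]
    · rw [pairRank_eq hT, deficit, Finset.sum_eq_zero]
      · simp [hu, hv]
      · rintro q -
        rw [if_neg]
        rintro ⟨h1, h2, h3, -⟩
        exact Finset.mem_compl.1 (hB.2 u (Finset.mem_compl.2 hu) v (Finset.mem_compl.2 hv)
          q h2 h3) h1

theorem twiceRank_block (hT : T.IsTree) {pos B : Finset V} (hB : IsSignedBuildingBlock T pos B) :
    twiceRank T pos B = B.card ^ 2 + B.card := by
  have h : ∀ u v, pairRank T pos B u v =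
      (if u ∈ B then 1 else 0) * (if v ∈ B then 1 else 0) -
        if u = v then (if u ∈ B then 1 else 0) else 0 := by
    intro u v
    by_cases huv : u = v
    · subst huv
      rw [pairRank_self hT]
      by_cases hu : u ∈ B <;> simp [hu]
    · rw [pairRank_block hT hB huv]
      by_cases hu : u ∈ B <;> by_cases hv : v ∈ B <;> simp [hu, hv, huv]
  rw [twiceRank_eq_sum_pairRank]
  simp_rw [h, Finset.sum_sub_distrib, ← Finset.sum_mul_sum]
  simp
  ring

theorem isSignedBuildingBlock_univ (pos : Finset V) :
    IsSignedBuildingBlock T pos Finset.univ :=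
  ⟨fun _ _ _ _ _ _ _ => Finset.mem_univ _, fun p hp => by simp at hp⟩

theorem twiceRank_univ (hT : T.IsTree) (pos : Finset V) :
    twiceRank T pos Finset.univ = Fintype.card V ^ 2 + Fintype.card V :=
  twiceRank_block hT (isSignedBuildingBlock_univ pos)

/-! ### Supermodularity -/

/-- The number `0` or `1` recording whether the last stop lies in `R`. -/
noncomputable def stopValue (T : SimpleGraph V) (pos R : Finset V) (u q : V) : ℤ :=
  if LastStop T pos R u q then 1 else 0

/-- The invariant holds what the next step and the final vertex require: the bit is monotone in the
set, and both the deficit and the deficit minus the bit are submodular. At the end, the last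
inequality serves $v \in R \cap S$; otherwise the deficit inequality and monotonicity suffice. -/
theorem pairRank_supermodular_aux (hT : T.IsTree) (pos R S : Finset V) (u : V) :
    ∀ w, u ≠ w →
      ((LastStop T pos (R ∩ S) u w → LastStop T pos R u w ∧ LastStop T pos S u w) ∧
        (LastStop T pos R u w ∨ LastStop T pos S u w → LastStop T pos (R ∪ S) u w)) ∧
      deficit T pos (R ∩ S) u w + deficit T pos (R ∪ S) u w ≤
        deficit T pos R u w + deficit T pos S u w ∧
      deficit T pos (R ∩ S) u w + deficit T pos (R ∪ S) u w +
          stopValue T pos R u w + stopValue T pos S u w ≤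
        deficit T pos R u w + deficit T pos S u w + stopValue T pos (R ∩ S) u w +
          stopValue T pos (R ∪ S) u w := by
  refine path_induction hT u ?_ ?_
  · intro v hv
    simp only [deficit_adj hT hv, stopValue, lastStop_adj hT hv, Finset.mem_inter, Finset.mem_union]
    by_cases h1 : u ∈ R <;> by_cases h2 : u ∈ S <;> simp [h1, h2]
  · intro v w hvu _ hvw hv
    simp only [deficit_step hT hvu hvw hv, stopValue, lastStop_step hT hvu hvw hv,
      Finset.mem_inter, Finset.mem_union]
    generalize LastStop T pos (R ∩ S) u v = a
    generalize LastStop T pos R u v = b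
    generalize LastStop T pos S u v = c
    generalize LastStop T pos (R ∪ S) u v = d
    generalize deficit T pos (R ∩ S) u v = a'
    generalize deficit T pos R u v = b'
    generalize deficit T pos S u v = c'
    generalize deficit T pos (R ∪ S) u v = d'
    by_cases hp : v ∈ pos <;> by_cases h1 : v ∈ R <;> by_cases h2 : v ∈ S <;>
      by_cases b <;> by_cases c <;> by_cases a <;> by_cases d <;> simp [*] <;> omega

theorem pairRank_supermodular (hT : T.IsTree) (pos R S : Finset V) (u v : V) :
    pairRank T pos R u v + pairRank T pos S u v ≤
      pairRank T pos (R ∩ S) u v + pairRank T pos (R ∪ S) u v := by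
  by_cases huv : u = v
  · subst huv
    simp [pairRank_self hT]
  · obtain ⟨⟨h1, h2⟩, h3, h4⟩ := pairRank_supermodular_aux hT pos R S u v huv
    simp only [pairRank_eq hT, Finset.mem_inter, Finset.mem_union]
    unfold stopValue at h4
    by_cases hR : v ∈ R <;> by_cases hS : v ∈ S <;>
      by_cases hb : LastStop T pos R u v <;> by_cases hc : LastStop T pos S u v <;>
      by_cases ha : LastStop T pos (R ∩ S) u v <;> by_cases hd : LastStop T pos (R ∪ S) u v <;>
      simp [*] at h1 h2 h3 h4 ⊢ <;> omega

theorem twiceRank_supermodular (hT : T.IsTree) (pos R S : Finset V) :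
    twiceRank T pos R + twiceRank T pos S ≤ twiceRank T pos (R ∩ S) + twiceRank T pos (R ∪ S) := by
  simp only [twiceRank_eq_sum_pairRank]
  have h1 : ((R ∩ S).card : ℤ) + (R ∪ S).card = R.card + S.card := by
    exact_mod_cast Finset.card_inter_add_card_union R S
  have h2 : (∑ u, ∑ v, pairRank T pos R u v) + (∑ u, ∑ v, pairRank T pos S u v) ≤
      (∑ u, ∑ v, pairRank T pos (R ∩ S) u v) + ∑ u, ∑ v, pairRank T pos (R ∪ S) u v := by
    simp only [← Finset.sum_add_distrib]
    exact Finset.sum_le_sum fun u _ => Finset.sum_le_sum fun v _ =>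
      pairRank_supermodular hT pos R S u v
  linarith

/-! ### Exchanging the signs -/

/-- Exchanging signs and complementing the set flips the bit at every stage, so the two deficits
count its upward and its downward changes. Their difference is the final bit minus the initial one.
-/
theorem lastStop_compl_aux (hT : T.IsTree) (pos R : Finset V) (u : V) :
    ∀ w, u ≠ w → (LastStop T posᶜ Rᶜ u w ↔ ¬ LastStop T pos R u w) ∧
      stopValue T pos R u w - (if u ∈ R then 1 else 0) =
        deficit T pos R u w - deficit T posᶜ Rᶜ u w := by
  refine path_induction hT u ?_ ?_
  · intro v hv
    simp [deficit_adj hT hv, stopValue, lastStop_adj hT hv]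
  · intro v w hvu _ hvw hv
    simp only [deficit_step hT hvu hvw hv, stopValue, lastStop_step hT hvu hvw hv,
      Finset.mem_compl]
    generalize LastStop T pos R u v = a
    generalize LastStop T posᶜ Rᶜ u v = b
    by_cases hp : v ∈ pos <;> by_cases h1 : v ∈ R <;> by_cases a <;> by_cases b <;>
      simp [*] <;> omega

theorem pairRank_compl (hT : T.IsTree) (pos R : Finset V) {u v : V} (huv : u ≠ v) :
    pairRank T pos R u v = pairRank T posᶜ Rᶜ u v +
      (if u ∈ R then 1 else 0) + (if v ∈ R then 1 else 0) - 1 := by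
  obtain ⟨h1, h2⟩ := lastStop_compl_aux hT pos R u v huv
  simp only [pairRank_eq hT, Finset.mem_compl, h1]
  unfold stopValue at h2
  by_cases hu : u ∈ R <;> by_cases hv : v ∈ R <;> by_cases ha : LastStop T pos R u v <;>
    simp [*] at h2 ⊢ <;> omega

theorem twiceRank_compl (hT : T.IsTree) (pos R : Finset V) :
    twiceRank T pos R = twiceRank T posᶜ Rᶜ + 2 * (Fintype.card V + 1) * R.card -
      Fintype.card V * (Fintype.card V + 1) := by
  -- The last term corrects the diagonal, where both pair ranks vanish.
  have h : ∀ u v, pairRank T pos R u v = pairRank T posᶜ Rᶜ u v +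
      (if u ∈ R then 1 else 0) + (if v ∈ R then 1 else 0) - 1 -
        if u = v then (2 * (if u ∈ R then 1 else 0) - 1) else 0 := by
    intro u v
    by_cases huv : u = v
    · subst huv
      simp only [pairRank_self hT, if_true]
      ring
    · simp [pairRank_compl hT pos R huv, huv]
  have hc : (Rᶜ.card : ℤ) = Fintype.card V - R.card := by
    rw [Finset.card_compl, Nat.cast_sub (Finset.card_le_univ R)]
  simp only [twiceRank_eq_sum_pairRank, h, Finset.sum_sub_distrib, Finset.sum_add_distrib, hc]
  simp
  ring

/-! ### Splitting at a vertex -/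

/-- The vertices that are not separated from `a` by `w`. -/
noncomputable def side (T : SimpleGraph V) (w a : V) : Finset V := {z | w ∉ pathSet T z a}

theorem mem_side {w a z : V} : z ∈ side T w a ↔ w ∉ pathSet T z a := by simp [side]

theorem mem_pathSet_of_side (hT : T.IsTree) {w a p q : V} (hp : p ∈ side T w a)
    (hq : q ∉ side T w a) : w ∈ pathSet T p q := by
  rw [mem_side] at hp hq
  by_contra h
  rw [pathSet_comm hT] at h
  exact hq (not_mem_pathSet_trans hT h hp)

theorem side_convex (hT : T.IsTree) {w a p q z : V} (hp : p ∈ side T w a)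
    (hq : q ∈ side T w a) (hz : z ∈ pathSet T p q) : z ∈ side T w a := by
  by_contra h
  have h1 := mem_pathSet_of_side hT hp h
  rw [mem_side] at hp hq
  rw [pathSet_comm hT q] at hq
  exact not_mem_pathSet_trans hT hp hq (pathSet_trans hT hz h1)

/-- A path entering the side from outside and leaving it again would pass through $w$ twice. -/
theorem side_compl_convex (hT : T.IsTree) {w a p q z : V} (hp : p ∉ side T w a)
    (hq : q ∉ side T w a) (hz : z ∈ pathSet T p q) : z ∉ side T w a := by
  intro h
  have h1 := mem_pathSet_of_side hT h hp
  have h2 := mem_pathSet_of_side hT h hq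
  rw [pathSet_comm hT] at h1
  have : z = w := by
    refine eq_of_mem_pathSet hT (u := p) ?_ h1
    rw [mem_pathSet_iff_dist hT] at *
    have := hT.connected.dist_triangle (u := p) (v := w) (w := q)
    have := hT.connected.dist_triangle (u := p) (v := z) (w := w)
    omega
  subst this
  exact mem_side.1 h (left_mem_pathSet hT _ _)

/-- A negative vertex outside $R$ blocks every view across it, so pairs that see each other lie on
one side. -/
theorem sees_split (hT : T.IsTree) {pos R : Finset V} {w : V} (hw : w ∉ pos) (hR : w ∉ R)
    (a p q : V) : Sees T pos R p q ↔
      Sees T pos (R ∩ side T w a) p q ∨ Sees T pos (R \ side T w a) p q := by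
  constructor
  · rintro ⟨hp, hq, hne, hz⟩
    have hw' : w ∉ pathSet T p q := by
      intro h
      have := (hz w h (by rintro rfl; exact hR hp) (by rintro rfl; exact hR hq)).2 hR
      exact hw this
    by_cases h1 : p ∈ side T w a <;> by_cases h2 : q ∈ side T w a
    · left
      refine ⟨by simp [*], by simp [*], hne, fun z h3 h4 h5 => ?_⟩
      simp [hz z h3 h4 h5, side_convex hT h1 h2 h3]
    · exact absurd (mem_pathSet_of_side hT h1 h2) hw'
    · rw [pathSet_comm hT] at hw'
      exact absurd (mem_pathSet_of_side hT h2 h1) hw'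
    · right
      refine ⟨by simp [*], by simp [*], hne, fun z h3 h4 h5 => ?_⟩
      simp [hz z h3 h4 h5, side_compl_convex hT h1 h2 h3]
  · rintro (⟨hp, hq, hne, hz⟩ | ⟨hp, hq, hne, hz⟩)
    · rw [Finset.mem_inter] at hp hq
      refine ⟨hp.1, hq.1, hne, fun z h3 h4 h5 => ?_⟩
      simp [hz z h3 h4 h5, side_convex hT hp.2 hq.2 h3]
    · rw [Finset.mem_sdiff] at hp hq
      refine ⟨hp.1, hq.1, hne, fun z h3 h4 h5 => ?_⟩
      simp [hz z h3 h4 h5, side_compl_convex hT hp.2 hq.2 h3]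

theorem twiceRank_split (hT : T.IsTree) {pos R : Finset V} {w : V} (hw : w ∉ pos) (hR : w ∉ R)
    (a : V) :
    twiceRank T pos R = twiceRank T pos (R ∩ side T w a) + twiceRank T pos (R \ side T w a) := by
  have h : ∀ p q, (if Sees T pos R p q then
      ((shadow T pos p q).card : ℤ) * ((shadow T pos q p).card : ℤ) else 0) =
      (if Sees T pos (R ∩ side T w a) p q then
        ((shadow T pos p q).card : ℤ) * ((shadow T pos q p).card : ℤ) else 0) +
      if Sees T pos (R \ side T w a) p q then
        ((shadow T pos p q).card : ℤ) * ((shadow T pos q p).card : ℤ) else 0 := by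
    intro p q
    have hn : ¬ (Sees T pos (R ∩ side T w a) p q ∧ Sees T pos (R \ side T w a) p q) :=
      fun h => (Finset.mem_sdiff.1 h.2.1).2 (Finset.mem_inter.1 h.1.1).2
    rw [sees_split hT hw hR a]
    by_cases h1 : Sees T pos (R ∩ side T w a) p q
    · simp [h1, not_and.1 hn h1]
    · simp [h1]
  have h2 := Finset.sum_inter_add_sum_sdiff R (side T w a)
    (fun p => (2 - if p ∈ pos then numSeparated T p else 0 : ℤ))
  simp only [twiceRank, h, Finset.sum_add_distrib, ← h2]
  ring

theorem twiceRank_split_compl (hT : T.IsTree) {pos R : Finset V} {w : V} (hw : w ∈ pos)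
    (hR : w ∈ R) (a : V) :
    twiceRank T pos R + twiceRank T pos Finset.univ =
      twiceRank T pos (R ∪ side T w a) + twiceRank T pos (R ∪ (side T w a)ᶜ) := by
  -- With signs exchanged and the set complemented, `w` is a negative vertex outside the set; the
  -- correction in `twiceRank_compl` is affine in the cardinality, hence harmless.
  have h := twiceRank_split hT (pos := posᶜ) (R := Rᶜ) (w := w) (by simpa) (by simpa) a
  rw [twiceRank_compl hT pos R, twiceRank_compl hT pos (R ∪ side T w a),
    twiceRank_compl hT pos (R ∪ (side T w a)ᶜ), twiceRank_univ hT, h]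
  have h1 : (R ∪ side T w a)ᶜ = Rᶜ \ side T w a := by ext; simp
  have h2 : (R ∪ (side T w a)ᶜ)ᶜ = Rᶜ ∩ side T w a := by ext; simp
  have h3 : ((R ∪ side T w a).card : ℤ) + (R ∪ (side T w a)ᶜ).card = R.card + Fintype.card V := by
    have := Finset.card_union_add_card_inter (R ∪ side T w a) (R ∪ (side T w a)ᶜ)
    have h4 : (R ∪ side T w a) ∪ (R ∪ (side T w a)ᶜ) = Finset.univ := by ext; simp; tauto
    have h5 : (R ∪ side T w a) ∩ (R ∪ (side T w a)ᶜ) = R := by ext; simp; tauto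
    rw [h4, h5, Finset.card_univ] at this
    rw [add_comm (R.card : ℤ)]
    exact_mod_cast this.symm
  rw [h1, h2]
  linear_combination (2 * (Fintype.card V + 1 : ℤ)) * (-h3)

/-! ### The inequalities of the signed tree associahedron -/

theorem cast_choose_succ_two (n : ℕ) : (((n + 1).choose 2 : ℕ) : ℝ) = ((n : ℝ) ^ 2 + n) / 2 := by
  rw [Nat.cast_choose_two]
  push_cast
  ring

/-- `D` is attached to `R` through `w`: a path from `D` to a vertex outside `D` passes `w`, so that
end can be replaced by `w ∈ R`. -/
theorem ConvexFor.union_of_separated (hT : T.IsTree) {S R D : Finset V} (hR : ConvexFor T S R)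
    {w : V} (hw : w ∈ R) (hD : ∀ p ∈ D, ∀ q ∉ D, w ∈ pathSet T p q) : ConvexFor T S (R ∪ D) := by
  have key : ∀ p ∈ D, ∀ q, ∀ v ∉ D, v ∈ pathSet T p q → v ∈ pathSet T w q :=
    fun p hp q v hv h => mem_pathSet_of_mem_of_mem hT (hD p hp v hv) h
  intro p hp q hq v hvS hv
  by_contra hvn
  rw [Finset.mem_union, not_or] at hvn
  rw [Finset.mem_union] at hp hq
  have hwv : v ≠ w := by rintro rfl; exact hvn.1 hw
  rcases hp with hp | hp <;> rcases hq with hq | hq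
  · exact hvn.1 (hR p hp q hq v hvS hv)
  · rw [pathSet_comm hT] at hv
    exact hvn.1 (hR w hw p hp v hvS (key q hq p v hvn.2 hv))
  · exact hvn.1 (hR w hw q hq v hvS (key p hp q v hvn.2 hv))
  · have h1 := key p hp q v hvn.2 hv
    have h2 := hD q hq v hvn.2
    rw [pathSet_comm hT] at h1
    exact hwv (eq_of_mem_pathSet hT h1 h2)

/-- If the complement is not positive convex, some positive $w \in R$ separates two vertices outside
$R$. Adding to $R$ either side of $w$ gives two larger negative convex sets, and modularity together
with the equation for the total sum recovers the bound for $R$. -/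
theorem twiceRank_le_of_convexFor (hT : T.IsTree) {pos : Finset V} {x : V → ℝ}
    (hx : x ∈ asso T pos) (R : Finset V) (hR : ConvexFor T posᶜ R) :
    (twiceRank T pos R : ℝ) ≤ 2 * ∑ v ∈ R, x v := by
  induction h : Rᶜ.card using Nat.strong_induction_on generalizing R with
  | _ n ih =>
  by_cases hR' : ConvexFor T pos Rᶜ
  · have h1 := hx.2 R ⟨hR, hR'⟩
    rw [cast_choose_succ_two] at h1
    rw [twiceRank_block hT ⟨hR, hR'⟩]
    push_cast
    linarith
  · simp only [ConvexFor, not_forall, Finset.mem_compl, not_not] at hR'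
    obtain ⟨p, hp, q, hq, w, hw, hpq, hwR⟩ := hR'
    have hpw : p ∈ side T w p := by
      rw [mem_side, mem_pathSet_self hT]; rintro rfl; exact hp hwR
    have hqw : q ∉ side T w p := by rwa [mem_side, not_not, pathSet_comm hT]
    have h1 := ih _ (h ▸ Finset.card_lt_card (by
        rw [Finset.compl_ssubset_compl, Finset.ssubset_iff_of_subset Finset.subset_union_left]
        exact ⟨p, by simp [hpw], hp⟩)) (R ∪ side T w p)
      (hR.union_of_separated hT hwR fun a ha b hb => mem_pathSet_of_side hT ha hb) rfl
    have h2 := ih _ (h ▸ Finset.card_lt_card (by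
        rw [Finset.compl_ssubset_compl, Finset.ssubset_iff_of_subset Finset.subset_union_left]
        exact ⟨q, by simp [hqw], hq⟩)) (R ∪ (side T w p)ᶜ)
      (hR.union_of_separated hT hwR fun a ha b hb => by
        rw [pathSet_comm hT]
        exact mem_pathSet_of_side hT (by simpa using hb) (by simpa using ha)) rfl
    have h3 := twiceRank_split_compl hT hw hwR p
    rw [twiceRank_univ hT] at h3
    have h4 : (∑ v ∈ R ∪ side T w p, x v) + (∑ v ∈ R ∪ (side T w p)ᶜ, x v) =
        (∑ v ∈ R, x v) + ∑ v, x v := by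
      rw [← Finset.sum_union_inter, add_comm]
      congr 2 <;> (ext; simp; try tauto)
    rw [hx.1, cast_choose_succ_two] at h4
    have h5 := congrArg (Int.cast : ℤ → ℝ) h3
    push_cast at h5
    linarith

/-- Without negative convexity, some negative $w \notin R$ separates two elements of $R$; cutting
there gives two smaller sets whose bounds add up. -/
theorem twiceRank_le (hT : T.IsTree) {pos : Finset V} {x : V → ℝ}
    (hx : x ∈ asso T pos) (R : Finset V) : (twiceRank T pos R : ℝ) ≤ 2 * ∑ v ∈ R, x v := by
  induction h : R.card using Nat.strong_induction_on generalizing R with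
  | _ n ih =>
  by_cases hR : ConvexFor T posᶜ R
  · exact twiceRank_le_of_convexFor hT hx R hR
  · simp only [ConvexFor, not_forall, Finset.mem_compl] at hR
    obtain ⟨p, hp, q, hq, w, hw, hpq, hwR⟩ := hR
    have hpw : p ∈ side T w p := by
      rw [mem_side, mem_pathSet_self hT]; rintro rfl; exact hwR hp
    have hqw : q ∉ side T w p := by rwa [mem_side, not_not, pathSet_comm hT]
    have h1 := ih _ (h ▸ Finset.card_lt_card (by
        rw [Finset.ssubset_iff_of_subset Finset.inter_subset_left]
        exact ⟨q, hq, by simp [hqw]⟩)) (R ∩ side T w p) rfl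
    have h2 := ih _ (h ▸ Finset.card_lt_card (by
        rw [Finset.ssubset_iff_of_subset Finset.sdiff_subset]
        exact ⟨p, hp, by simp [hpw]⟩)) (R \ side T w p) rfl
    rw [twiceRank_split hT hw hwR p, ← Finset.sum_inter_add_sum_sdiff R (side T w p)]
    push_cast
    linarith

theorem mem_asso_of_twiceRank_le (hT : T.IsTree) {pos : Finset V} {x : V → ℝ}
    (h : ∀ R, (twiceRank T pos R : ℝ) ≤ 2 * ∑ v ∈ R, x v)
    (h' : 2 * ∑ v, x v = twiceRank T pos Finset.univ) : x ∈ asso T pos := by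
  constructor
  · rw [twiceRank_univ hT] at h'
    rw [cast_choose_succ_two]
    push_cast at h'
    linarith
  · intro B hB
    have := h B
    rw [twiceRank_block hT hB] at this
    rw [cast_choose_succ_two]
    push_cast at this
    linarith

/-! ### Minkowski sums of faces of the standard simplex -/

/-- `m` selects in every nonempty set of coordinates one at which `w` is minimal. -/
def IsMinSelection (w : V → ℝ) (m : Finset V → V) : Prop :=
  ∀ U : Finset V, U.Nonempty → m U ∈ U ∧ ∀ u ∈ U, w (m U) ≤ w u

theorem IsMinSelection.le_of_mem_simplexFace {w : V → ℝ} {m : Finset V → V}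
    (hm : IsMinSelection w m) {U : Finset V} (hU : U.Nonempty) {z : V → ℝ}
    (hz : z ∈ simplexFace U) : w (m U) ≤ ∑ v, w v * z v := by
  have hc : Convex ℝ {z : V → ℝ | w (m U) ≤ ∑ v, w v * z v} := by
    refine convex_halfSpace_ge (𝕜 := ℝ) (f := fun z : V → ℝ => ∑ v, w v * z v) ⟨fun x y => ?_, fun c x => ?_⟩ _
    · simp [mul_add, Finset.sum_add_distrib]
    · simp [Finset.mul_sum, mul_left_comm]
  refine convexHull_min (𝕜 := ℝ) ?_ hc hz
  rintro _ ⟨u, hu, rfl⟩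
  simp [Pi.single_apply, (hm U hU).2 u hu]

theorem single_mem_simplexFace {U : Finset V} {u : V} (hu : u ∈ U) :
    (Pi.single u 1 : V → ℝ) ∈ simplexFace U :=
  subset_convexHull _ _ ⟨u, hu, rfl⟩

theorem isCompact_simplexFace (U : Finset V) : IsCompact (simplexFace U) :=
  (U.finite_toSet.image _).isCompact_convexHull ℝ

theorem isCompact_sum_smul_simplexFace (s : Finset (Finset V)) (c : Finset V → ℝ) :
    IsCompact (∑ U ∈ s, c U • simplexFace U) := by
  induction s using Finset.induction_on with
  | empty => simp
  | insert U s hU ih =>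
    rw [Finset.sum_insert hU]
    exact ((isCompact_simplexFace U).smul (c U)).add ih

theorem convex_sum_smul_simplexFace (s : Finset (Finset V)) (c : Finset V → ℝ) :
    Convex ℝ (∑ U ∈ s, c U • simplexFace U) :=
  convex_sum _ fun U _ => (convex_convexHull ℝ _).smul (c U)

theorem IsMinSelection.le_of_mem_sum {w : V → ℝ} {m : Finset V → V} (hm : IsMinSelection w m)
    {s : Finset (Finset V)} (hs : ∀ U ∈ s, U.Nonempty) {c : Finset V → ℝ}
    (hc : ∀ U ∈ s, 0 ≤ c U) {z : V → ℝ} (hz : z ∈ ∑ U ∈ s, c U • simplexFace U) :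
    ∑ U ∈ s, c U * w (m U) ≤ ∑ v, w v * z v := by
  rw [Set.mem_finsetSum] at hz
  obtain ⟨g, hg, rfl⟩ := hz
  simp only [Finset.sum_apply, Finset.mul_sum]
  rw [Finset.sum_comm]
  refine Finset.sum_le_sum fun U hU => ?_
  obtain ⟨z, hz, hzU⟩ := hg hU
  rw [← hzU]
  simp only [Pi.smul_apply, smul_eq_mul, mul_left_comm _ (c U), ← Finset.mul_sum]
  exact mul_le_mul_of_nonneg_left (hm.le_of_mem_simplexFace (hs U hU) hz) (hc U hU)

theorem IsMinSelection.exists_mem_sum {w : V → ℝ} {m : Finset V → V} (hm : IsMinSelection w m)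
    {s : Finset (Finset V)} (hs : ∀ U ∈ s, U.Nonempty) (c : Finset V → ℝ) :
    ∃ z ∈ ∑ U ∈ s, c U • simplexFace U, ∑ v, w v * z v = ∑ U ∈ s, c U * w (m U) := by
  refine ⟨∑ U ∈ s, c U • (Pi.single (m U) 1 : V → ℝ), ?_, ?_⟩
  · exact Set.finsetSum_mem_finsetSum _ _ _ fun U hU =>
      Set.smul_mem_smul_set (single_mem_simplexFace (hm U (hs U hU)).1)
  · simp only [Finset.sum_apply, Finset.mul_sum]
    rw [Finset.sum_comm]
    refine Finset.sum_congr rfl fun U _ => ?_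
    simp [Pi.single_apply, mul_comm]

/-- The value `∑ U, y U * min_U w` of the support function of the Minkowski sum and difference
with coefficients `y`. -/
noncomputable def supportValue (y : Finset V → ℝ) (w : V → ℝ) (m : Finset V → V) : ℝ :=
  ∑ U : Finset V with U.Nonempty, y U * w (m U)

theorem supportValue_add (y : Finset V → ℝ) (w : V → ℝ) (m : Finset V → V) :
    supportValue y w m + ∑ U : Finset V with U.Nonempty ∧ y U < 0, -y U * w (m U) =
      ∑ U : Finset V with U.Nonempty ∧ 0 < y U, y U * w (m U) := by
  simp only [supportValue, Finset.sum_filter, ← Finset.sum_add_distrib]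
  refine Finset.sum_congr rfl fun U _ => ?_
  by_cases hU : U.Nonempty
  · rcases lt_trichotomy (y U) 0 with h | h | h
    · simp [hU, h, h.le]
    · simp [hU, h]
    · simp [hU, h, h.le]
  · simp [hU]

theorem IsMinkowskiDecomposition.isLeast {P : Set (V → ℝ)} {y : Finset V → ℝ}
    (h : IsMinkowskiDecomposition P y) {w : V → ℝ} {m : Finset V → V} (hm : IsMinSelection w m) :
    IsLeast ((fun x : V → ℝ => ∑ v, w v * x v) '' P) (supportValue y w m) := by
  have hn : ∀ U ∈ Finset.univ.filter (fun U : Finset V => U.Nonempty ∧ y U < 0), U.Nonempty :=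
    fun U hU => (Finset.mem_filter.1 hU).2.1
  have hp : ∀ U ∈ Finset.univ.filter (fun U : Finset V => U.Nonempty ∧ 0 < y U), U.Nonempty :=
    fun U hU => (Finset.mem_filter.1 hU).2.1
  have hadd := supportValue_add y w m
  have hge : ∀ x ∈ P, supportValue y w m ≤ ∑ v, w v * x v := by
    intro x hx
    -- Adding a minimiser of the negative part to `x` lands in the positive part, whose minimum is
    -- known.
    obtain ⟨n, hnm, hnw⟩ := hm.exists_mem_sum hn (fun U => -y U)
    have hq := hm.le_of_mem_sum hp (fun U hU => (Finset.mem_filter.1 hU).2.2.le)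
      (h.2 ▸ Set.add_mem_add hx hnm)
    simp only [Pi.add_apply, mul_add, Finset.sum_add_distrib] at hq
    linarith
  refine ⟨?_, by rintro _ ⟨x, hx, rfl⟩; exact hge x hx⟩
  obtain ⟨q, hq, hqw⟩ := hm.exists_mem_sum hp y
  rw [← h.2] at hq
  obtain ⟨x, hx, n, hnm, rfl⟩ := hq
  have h1 := hm.le_of_mem_sum hn
    (fun U hU => (neg_pos.2 (Finset.mem_filter.1 hU).2.2).le) hnm
  have h2 := hge x hx
  simp only [Pi.add_apply, mul_add, Finset.sum_add_distrib] at hqw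
  exact ⟨x, hx, by dsimp only; linarith⟩

theorem IsMinkowskiDecomposition.unique {P : Set (V → ℝ)} {y y' : Finset V → ℝ}
    (h : IsMinkowskiDecomposition P y) (h' : IsMinkowskiDecomposition P y') : y = y' := by
  have key : ∀ R : Finset V, ∑ U ∈ R.powerset, y U = ∑ U ∈ R.powerset, y' U := by
    intro R
    rcases isEmpty_or_nonempty V with hV | hV
    · have : R = ∅ := Finset.eq_empty_of_isEmpty R
      simp [this, h.1, h'.1]
    -- Choosing outside `R` whenever possible minimises the indicator of `R`; its minimum over
    -- nonempty `U` is 1 exactly when `U ⊆ R`.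
    have hex : ∀ U : Finset V, ∃ v, U.Nonempty → v ∈ U ∧ (v ∈ R → U ⊆ R) := by
      intro U
      by_cases hU : U ⊆ R
      · by_cases hne : U.Nonempty
        · exact ⟨hne.choose, fun _ => ⟨hne.choose_spec, fun _ => hU⟩⟩
        · exact ⟨Classical.arbitrary V, fun h => absurd h hne⟩
      · obtain ⟨v, hv, hvR⟩ := Finset.not_subset.1 hU
        exact ⟨v, fun _ => ⟨hv, fun h => absurd h hvR⟩⟩
    choose m hm using hex
    have hmin : IsMinSelection (fun v => if v ∈ R then (1 : ℝ) else 0) m := by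
      intro U hU
      refine ⟨(hm U hU).1, fun u hu => ?_⟩
      by_cases h1 : m U ∈ R
      · simp [h1, (hm U hU).2 h1 hu]
      · simp only [h1, if_false]
        split_ifs <;> norm_num
    have hval : ∀ z : Finset V → ℝ, z ∅ = 0 →
        supportValue z (fun v => if v ∈ R then (1 : ℝ) else 0) m = ∑ U ∈ R.powerset, z U := by
      intro z hz
      rw [supportValue, Finset.sum_filter,
        ← Finset.sum_subset (Finset.subset_univ R.powerset)]
      · refine Finset.sum_congr rfl fun U hU => ?_
        by_cases hne : U.Nonempty
        · simp [hne, Finset.mem_powerset.1 hU (hm U hne).1]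
        · simp [Finset.not_nonempty_iff_eq_empty.1 hne, hz]
      · intro U _ hU
        rw [Finset.mem_powerset] at hU
        by_cases hne : U.Nonempty
        · simp [mt (hm U hne).2 hU]
        · simp [hne]
    rw [← hval y h.1, ← hval y' h'.1]
    exact (h.isLeast hmin).unique (h'.isLeast hmin)
  funext U
  induction U using Finset.strongInduction with
  | H U ih =>
    have := key U
    rw [← Finset.insert_erase (Finset.mem_powerset_self U),
      Finset.sum_insert (Finset.notMem_erase _ _), Finset.sum_insert (Finset.notMem_erase _ _),
      Finset.sum_congr rfl fun W hW => ih W ?_] at this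
    · linarith
    · rw [Finset.mem_erase, Finset.mem_powerset] at hW
      exact hW.2.ssubset_of_ne hW.1

/-- Both sides are closed and convex (a closed set plus a compact one is closed) with equal support
functions, so no hyperplane can separate a point of one from the other. -/
theorem isMinkowskiDecomposition_of_isLeast {P : Set (V → ℝ)} (hP : Convex ℝ P) (hc : IsClosed P)
    {y : Finset V → ℝ} (h0 : y ∅ = 0)
    (h : ∀ w : V → ℝ, ∃ m, IsMinSelection w m ∧
      IsLeast ((fun x : V → ℝ => ∑ v, w v * x v) '' P) (supportValue y w m)) :
    IsMinkowskiDecomposition P y := by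
  have hn : ∀ U ∈ Finset.univ.filter (fun U : Finset V => U.Nonempty ∧ y U < 0), U.Nonempty :=
    fun U hU => (Finset.mem_filter.1 hU).2.1
  have hp : ∀ U ∈ Finset.univ.filter (fun U : Finset V => U.Nonempty ∧ 0 < y U), U.Nonempty :=
    fun U hU => (Finset.mem_filter.1 hU).2.1
  have hf : ∀ (f : (V → ℝ) →L[ℝ] ℝ) (x : V → ℝ), f x = ∑ v, f (Pi.single v 1) * x v := by
    intro f x
    have := LinearMap.pi_apply_eq_sum_univ (f : (V → ℝ) →ₗ[ℝ] ℝ) x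
    simp only [ContinuousLinearMap.coe_coe, smul_eq_mul] at this
    rw [this]
    refine Finset.sum_congr rfl fun v _ => ?_
    rw [mul_comm]
    congr 2
    ext u
    simp [Pi.single_apply, eq_comm]
  refine ⟨h0, Set.Subset.antisymm ?_ ?_⟩
  · rintro _ ⟨x, hx, n, hnm, rfl⟩
    by_contra hcon
    obtain ⟨f, u, hu, hfu⟩ := geometric_hahn_banach_point_closed
      (convex_sum_smul_simplexFace _ _) (isCompact_sum_smul_simplexFace _ _).isClosed hcon
    obtain ⟨m, hm, hl⟩ := h fun v => f (Pi.single v 1)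
    obtain ⟨q, hq, hqw⟩ := hm.exists_mem_sum hp y
    have h1 := hm.le_of_mem_sum hn
      (fun U hU => (neg_pos.2 (Finset.mem_filter.1 hU).2.2).le) hnm
    have h2 := hl.2 ⟨x, hx, rfl⟩
    have h3 := supportValue_add y (fun v => f (Pi.single v 1)) m
    have h4 := hfu q hq
    dsimp only at hu h2
    rw [map_add, hf f x, hf f n] at hu
    rw [hf f q] at h4
    linarith
  · intro q hq
    by_contra hcon
    obtain ⟨f, u, hu, hfu⟩ := geometric_hahn_banach_point_closed
      (hP.add (convex_sum_smul_simplexFace _ _))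
      (hc.add_right_of_isCompact (isCompact_sum_smul_simplexFace _ _)) hcon
    obtain ⟨m, hm, ⟨x, hx, hxw⟩, -⟩ := h fun v => f (Pi.single v 1)
    obtain ⟨n, hnm, hnw⟩ := hm.exists_mem_sum hn (fun U => -y U)
    have h1 := hm.le_of_mem_sum hp (fun U hU => (Finset.mem_filter.1 hU).2.2.le) hq
    have h3 := supportValue_add y (fun v => f (Pi.single v 1)) m
    have h4 := hfu _ (Set.add_mem_add hx hnm)
    dsimp only at hxw
    rw [map_add, hf f x, hf f n] at h4
    rw [hf f q] at hu
    linarith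

/-! ### The greedy algorithm -/

theorem exists_rank (w : V → ℝ) :
    ∃ r : V → ℕ, Function.Injective r ∧ ∀ u v, r u ≤ r v → w v ≤ w u := by
  let e := Fintype.equivFin V
  let f : Fin (Fintype.card V) → ℝ := fun i => -w (e.symm i)
  refine ⟨fun v => (Tuple.sort f).symm (e v), ?_, fun u v huv => ?_⟩
  · exact Fin.val_injective.comp ((Tuple.sort f).symm.injective.comp e.injective)
  · have := Tuple.monotone_sort f (Fin.le_def.2 huv)
    simpa [f] using this

theorem exists_last [Nonempty V] (r : V → ℕ) :
    ∃ m : Finset V → V, ∀ U : Finset V, U.Nonempty → m U ∈ U ∧ ∀ u ∈ U, r u ≤ r (m U) := by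
  have hex : ∀ U : Finset V, ∃ v : V, U.Nonempty → v ∈ U ∧ ∀ u ∈ U, r u ≤ r v := by
    intro U
    by_cases hne : U.Nonempty
    · obtain ⟨v, hv, h⟩ := U.exists_max_image r hne
      exact ⟨v, fun _ => ⟨hv, h⟩⟩
    · exact ⟨Classical.arbitrary V, fun h => absurd h hne⟩
  choose m hm using hex
  exact ⟨m, hm⟩

/-- Order the vertices by decreasing $w$. The greedy point `x` gives each $y_U$ to the last element
of $U$, so it is tight on initial segments; supermodularity puts it in `P`, and Abel summation makes
it minimal. -/
theorem isMinkowskiDecomposition_of_supermodular [Nonempty V] {P : Set (V → ℝ)} {g : Finset V → ℝ}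
    (hP : ∀ x, x ∈ P ↔ (∀ R, g R ≤ ∑ v ∈ R, x v) ∧ ∑ v, x v = g Finset.univ)
    (hg : ∀ R S, g R + g S ≤ g (R ∩ S) + g (R ∪ S)) {y : Finset V → ℝ} (h0 : y ∅ = 0)
    (hy : ∀ R : Finset V, ∑ U ∈ R.powerset, y U = g R) :
    IsMinkowskiDecomposition P y := by
  have hP' : P = {x | ∑ v, x v = g Finset.univ} ∩ ⋂ R, {x | g R ≤ ∑ v ∈ R, x v} := by
    ext x
    simp [hP, and_comm]
  have hlin : ∀ R : Finset V, IsLinearMap ℝ (fun x : V → ℝ => ∑ v ∈ R, x v) := fun R =>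
    ⟨fun x y => by simp [Finset.sum_add_distrib], fun c x => by simp [Finset.mul_sum]⟩
  have hcont : ∀ R : Finset V, Continuous (fun x : V → ℝ => ∑ v ∈ R, x v) := fun R => by fun_prop
  refine isMinkowskiDecomposition_of_isLeast ?_ ?_ h0 fun w => ?_
  · rw [hP']
    exact (convex_hyperplane (hlin _) _).inter
      (convex_iInter fun R => convex_halfSpace_ge (hlin R) _)
  · rw [hP']
    exact (isClosed_eq (hcont _) continuous_const).inter
      (isClosed_iInter fun R => isClosed_le continuous_const (hcont R))
  obtain ⟨r, hr, hrw⟩ := exists_rank w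
  obtain ⟨m, hm⟩ := exists_last r
  refine ⟨m, fun U hU => ⟨(hm U hU).1, fun u hu => hrw _ _ ((hm U hU).2 u hu)⟩, ?_⟩
  let x : V → ℝ := fun v => ∑ U : Finset V with U.Nonempty ∧ m U = v, y U
  have hxsum : ∀ f : V → ℝ, ∑ v, f v * x v = ∑ U : Finset V with U.Nonempty, y U * f (m U) := by
    intro f
    rw [← Finset.sum_fiberwise _ m]
    refine Finset.sum_congr rfl fun v _ => ?_
    rw [Finset.mul_sum, Finset.filter_filter]
    refine Finset.sum_congr rfl fun U hU => ?_
    rw [(Finset.mem_filter.1 hU).2.2, mul_comm]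
  have hinit : ∀ s : Finset V, (∀ a ∈ s, ∀ b, r b ≤ r a → b ∈ s) → ∑ v ∈ s, x v = g s := by
    intro s hs
    have h1 := hxsum fun v => if v ∈ s then 1 else 0
    simp only [ite_mul, one_mul, zero_mul, Finset.sum_ite_mem, Finset.univ_inter] at h1
    rw [h1, ← hy s, Finset.sum_filter, ← Finset.sum_subset (Finset.subset_univ s.powerset)]
    · refine Finset.sum_congr rfl fun U hU => ?_
      by_cases hne : U.Nonempty
      · simp [hne, Finset.mem_powerset.1 hU (hm U hne).1]
      · simp [Finset.not_nonempty_iff_eq_empty.1 hne, h0]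
    · intro U _ hU
      rw [Finset.mem_powerset] at hU
      by_cases hne : U.Nonempty
      · have : m U ∉ s := fun h => hU fun u hu => hs _ h u ((hm U hne).2 u hu)
        simp [this]
      · simp [hne]
  have hempty : g ∅ = 0 := by rw [← hy]; simp [h0]
  have hxge : ∀ R, g R ≤ ∑ v ∈ R, x v := by
    intro R
    induction R using Finset.induction_on_max_value r with
    | empty => simp [hempty]
    | insert a s ha hs ih =>
      have h1 := hinit {u | r u ≤ r a} fun b hb c hc => by
        simp only [Finset.mem_filter, Finset.mem_univ, true_and] at hb ⊢
        omega
      have h2 := hinit {u | r u < r a} fun b hb c hc => by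
        simp only [Finset.mem_filter, Finset.mem_univ, true_and] at hb ⊢
        omega
      have hlt : ∀ u ∈ s, r u < r a := fun u hu =>
        lt_of_le_of_ne (hs u hu) fun h => ha (hr h ▸ hu)
      -- Uncrossing with the initial segment before `a` shows that adding `a` to `s` raises `g` by
      -- at most `x a`.
      have h3 := hg (insert a s) {u | r u < r a}
      have h4 : insert a s ∩ Finset.univ.filter (r · < r a) = s := by
        ext u
        simp only [Finset.mem_inter, Finset.mem_insert, Finset.mem_filter, Finset.mem_univ,
          true_and]
        constructor
        · rintro ⟨rfl | h, h'⟩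
          exacts [absurd h' (lt_irrefl _), h]
        · exact fun h => ⟨Or.inr h, hlt u h⟩
      have h5 : insert a s ∪ Finset.univ.filter (r · < r a) = Finset.univ.filter (r · ≤ r a) := by
        ext u
        simp only [Finset.mem_union, Finset.mem_insert, Finset.mem_filter, Finset.mem_univ,
          true_and]
        constructor
        · rintro ((rfl | h) | h)
          exacts [le_rfl, hs u h, h.le]
        · intro h
          rcases h.lt_or_eq with h | h
          exacts [Or.inr h, Or.inl (Or.inl (hr h))]
      have h6 : Finset.univ.filter (r · ≤ r a) = insert a (Finset.univ.filter (r · < r a)) := by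
        ext u
        simp [le_iff_eq_or_lt, hr.eq_iff]
      rw [h4, h5] at h3
      rw [h6, Finset.sum_insert (by simp), ← h6] at h1
      rw [Finset.sum_insert ha]
      linarith
  have hxP : x ∈ P := (hP x).2 ⟨hxge, hinit _ fun _ _ b _ => Finset.mem_univ b⟩
  refine ⟨⟨x, hxP, hxsum w⟩, ?_⟩
  rintro _ ⟨x', hx', rfl⟩
  rw [hP] at hx'
  dsimp only
  rw [supportValue, ← hxsum w]
  -- Abel summation as an induction: the excess of `x'` on an initial segment is nonnegative, so the
  -- multiplier `w a` may be lowered to any `c`. On the whole set the excess is zero.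
  have key : ∀ s : Finset V, (∀ a ∈ s, ∀ b, r b ≤ r a → b ∈ s) → ∀ c, (∀ a ∈ s, c ≤ w a) →
      c * (∑ v ∈ s, x' v - ∑ v ∈ s, x v) ≤ ∑ v ∈ s, w v * x' v - ∑ v ∈ s, w v * x v := by
    intro s
    induction s using Finset.induction_on_max_value r with
    | empty => simp
    | insert a s ha hs ih =>
      intro hinit' c hc
      have hpos : 0 ≤ ∑ v ∈ insert a s, x' v - ∑ v ∈ insert a s, x v := by
        rw [hinit _ hinit', sub_nonneg]
        exact hx'.1 _
      have h1 := ih (fun b hb d hd => by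
        have := hinit' b (Finset.mem_insert_of_mem hb) d hd
        rcases Finset.mem_insert.1 this with rfl | h
        · exact absurd (hr (le_antisymm (hs b hb) hd)) (by rintro rfl; exact ha hb)
        · exact h) (w a) (fun b hb => hrw _ _ (hs b hb))
      have h2 := mul_le_mul_of_nonneg_right (hc a (Finset.mem_insert_self a s)) hpos
      refine h2.trans ?_
      simp only [Finset.sum_insert ha]
      linarith
  obtain ⟨v₀, -, hv₀⟩ := Finset.univ.exists_min_image w Finset.univ_nonempty
  have := key Finset.univ (fun _ _ b _ => Finset.mem_univ b) (w v₀) hv₀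
  rw [hx'.2, hinit _ fun _ _ b _ => Finset.mem_univ b, sub_self, mul_zero] at this
  linarith

/-! ### The weights in terms of betweenness -/

/-- The branch at `p` that contains `u`. -/
def branchOf (T : SimpleGraph V) (p : V) (u : ({p}ᶜ : Set V)) : Branch T p :=
  (T.induce ({p}ᶜ : Set V)).connectedComponentMk u

theorem branchOf_eq_iff (hT : T.IsTree) {p : V} (u v : ({p}ᶜ : Set V)) :
    branchOf T p u = branchOf T p v ↔ p ∉ pathSet T u v := by
  rw [branchOf, branchOf, SimpleGraph.ConnectedComponent.eq, reachable_induce_iff hT]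

theorem mem_verts_iff {p : V} {C : Branch T p} (u : ({p}ᶜ : Set V)) :
    (u : V) ∈ C.verts ↔ branchOf T p u = C := by
  simp only [Branch.verts, Set.mem_image, SimpleGraph.ConnectedComponent.mem_supp_iff]
  constructor
  · rintro ⟨x, hx, hxu⟩
    rw [← hx, branchOf, Subtype.ext hxu]
  · exact fun h => ⟨u, h, rfl⟩

theorem ncard_verts {p : V} (C : Branch T p) :
    (C.verts.ncard : ℝ) = ∑ u : ({p}ᶜ : Set V), if branchOf T p u = C then 1 else 0 := by
  rw [Branch.verts, Set.ncard_image_of_injective _ Subtype.val_injective, Set.ncard_eq_toFinset_card']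
  simp only [Finset.sum_boole]
  congr 2
  ext u
  rw [Set.mem_toFinset, SimpleGraph.ConnectedComponent.mem_supp_iff]
  exact (Finset.mem_filter_univ (p := fun u => branchOf T p u = C) u).symm

theorem sum_mul_ncard_verts (p : V) (f : Branch T p → ℝ) :
    ∑ C : Branch T p, f C * (C.verts.ncard : ℝ) = ∑ u : ({p}ᶜ : Set V), f (branchOf T p u) := by
  simp only [ncard_verts, Finset.mul_sum]
  rw [Finset.sum_comm]
  simp

theorem sum_subtype_compl_singleton (p : V) (f : V → ℝ) :
    ∑ u : ({p}ᶜ : Set V), f u = ∑ u, if u = p then 0 else f u := by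
  rw [← Finset.sum_subtype (Finset.univ.filter (· ≠ p)) (by simp) f, Finset.sum_filter]
  simp

theorem omega_of_mem (hT : T.IsTree) {pos : Finset V} {p q : V} (hp : p ∈ pos) (hpq : p ≠ q) :
    omega T pos p q = ((shadow T pos p q).card : ℝ) := by
  have h1 : ∑ C : Branch T p with q ∉ C.verts, (C.verts.ncard : ℝ) =
      ∑ u, if u = p then (0 : ℝ) else if p ∈ pathSet T u q then 1 else 0 := by
    rw [← sum_subtype_compl_singleton, Finset.sum_filter]
    have := sum_mul_ncard_verts (T := T) p fun C => if q ∉ C.verts then 1 else 0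
    simp only [ite_mul, one_mul, zero_mul] at this
    rw [this]
    refine Finset.sum_congr rfl fun u _ => ?_
    congr 1
    have := mem_verts_iff (C := branchOf T p u) ⟨q, hpq.symm⟩
    rw [this, branchOf_eq_iff hT, not_not, pathSet_comm hT]
  have h2 : ((shadow T pos p q).card : ℝ) = ∑ u, ((if u = p then (1 : ℝ) else 0) +
      if u = p then (0 : ℝ) else if p ∈ pathSet T u q then 1 else 0) := by
    rw [shadow, Finset.card_filter, Nat.cast_sum]
    refine Finset.sum_congr rfl fun u _ => ?_
    by_cases hu : u = p <;> simp [hu, hp]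
  rw [omega, if_pos hp, h1, h2, Finset.sum_add_distrib]
  simp

theorem omega_of_notMem {pos : Finset V} {p q : V} (hp : p ∉ pos) :
    omega T pos p q = -((shadow T pos p q).card : ℝ) := by
  have : shadow T pos p q = {p} := by ext; simp [shadow, hp]
  rw [omega, if_neg hp, this]
  simp

theorem mem_pathSet_of_adj_of_adj {p v w : V} (hv : T.Adj p v) (hw : T.Adj p w) (h : v ≠ w) :
    p ∈ pathSet T v w :=
  ⟨.cons hv.symm (.cons hw .nil), by simp [hv.ne', hw.ne, h], by simp⟩

theorem card_branch (hT : T.IsTree) (p : V) :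
    Fintype.card (Branch T p) = (T.neighborSet p).ncard := by
  rw [← Nat.card_eq_fintype_card, ← Nat.card_coe_set_eq]
  symm
  refine Nat.card_eq_of_bijective
    (fun v : T.neighborSet p => branchOf T p ⟨v, v.2.ne.symm⟩) ⟨?_, ?_⟩
  · intro v w h
    rw [branchOf_eq_iff hT] at h
    by_contra hne
    exact h (mem_pathSet_of_adj_of_adj v.2 w.2 fun h => hne (Subtype.ext h))
  · intro C
    obtain ⟨u, rfl⟩ := Quot.exists_rep C
    obtain ⟨v, hv, hvu⟩ := exists_adj_mem_pathSet hT (u := (u : V)) (w := p) u.2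
    refine ⟨⟨v, hv.symm⟩, ?_⟩
    change _ = branchOf T p u
    rw [branchOf_eq_iff hT, pathSet_comm hT]
    exact not_mem_pathSet_step hT hv hvu

/-- Since $|C| + |C'| = \nu - 1$, each summand is $\nu + |C||C'|$. There are $\deg p$ branches, and
$\sum |C||C'|$ counts the ordered pairs separated by $p$. -/
theorem two_mul_omegaTilde (hT : T.IsTree) {pos : Finset V} {p : V}
    (hp : p ∈ pos) : 2 * omegaTilde T pos p =
      (Fintype.card V : ℝ) * ((T.neighborSet p).ncard : ℝ) + (numSeparated T p : ℝ) := by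
  have h1 : ∑ C : Branch T p, (C.verts.ncard : ℝ) = Fintype.card V - 1 := by
    have := sum_mul_ncard_verts (T := T) p fun _ => 1
    simp only [one_mul] at this
    rw [this, sum_subtype_compl_singleton p (fun _ => 1)]
    simp [Finset.sum_ite, Finset.filter_ne', Finset.card_erase_of_mem]
    rw [Nat.cast_sub]
    · simp
    · exact Fintype.card_pos_iff.2 ⟨p⟩
  have h2 : ∀ C : Branch T p, ∑ C' : Branch T p with C' ≠ C, (C'.verts.ncard : ℝ) =
      Fintype.card V - 1 - C.verts.ncard := by
    intro C
    rw [Finset.filter_ne', ← h1, ← Finset.add_sum_erase _ _ (Finset.mem_univ C)]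
    ring
  have h3 : ∑ C : Branch T p, (∑ C' : Branch T p with C' ≠ C, (C'.verts.ncard : ℝ)) *
      (C.verts.ncard : ℝ) = numSeparated T p := by
    rw [sum_mul_ncard_verts p fun C => ∑ C' : Branch T p with C' ≠ C, (C'.verts.ncard : ℝ)]
    have h4 : ∀ u : ({p}ᶜ : Set V),
        ∑ C' : Branch T p with C' ≠ branchOf T p u, (C'.verts.ncard : ℝ) =
        ∑ v, if v = p then 0 else if p ∈ pathSet T u v then 1 else 0 := by
      intro u
      rw [← sum_subtype_compl_singleton, Finset.sum_filter]
      have := sum_mul_ncard_verts (T := T) p fun C => if C ≠ branchOf T p u then 1 else 0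
      simp only [ite_mul, one_mul, zero_mul] at this
      rw [this]
      refine Finset.sum_congr rfl fun v _ => ?_
      congr 1
      rw [ne_eq, branchOf_eq_iff hT, not_not, pathSet_comm hT]
    simp only [h4]
    rw [sum_subtype_compl_singleton p
      (fun u => ∑ v, if v = p then 0 else if p ∈ pathSet T u v then 1 else 0), numSeparated]
    push_cast
    refine Finset.sum_congr rfl fun u _ => ?_
    by_cases hu : u = p
    · simp [hu]
    · rw [if_neg hu]
      refine Finset.sum_congr rfl fun v _ => ?_
      by_cases hv : v = p
      · simp [hv]
      · simp [hv, Ne.symm hu, Ne.symm hv]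
  have h5 : ∀ C : Branch T p, (1 + (C.verts.ncard : ℝ)) *
      (1 + ∑ C' : Branch T p with C' ≠ C, (C'.verts.ncard : ℝ)) = Fintype.card V +
      (∑ C' : Branch T p with C' ≠ C, (C'.verts.ncard : ℝ)) * (C.verts.ncard : ℝ) := by
    intro C
    rw [h2]
    ring
  rw [omegaTilde, if_pos hp, Finset.sum_congr rfl fun C _ => h5 C, Finset.sum_add_distrib, h3,
    Finset.sum_const, Finset.card_univ, card_branch hT]
  simp only [nsmul_eq_mul]
  ring

/-! ### Negative paths -/

theorem IsNegativePathBetween.symm (hT : T.IsTree) {pos U : Finset V} {p q : V}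
    (h : IsNegativePathBetween T pos p q U) : IsNegativePathBetween T pos q p U := by
  obtain ⟨h1, h2, h3, h4⟩ := h
  rw [pathSet_comm hT] at h3 h4
  exact ⟨h2, h1, h3, h4⟩

/-- Each pair of endpoints lies on the path spanned by the other. Hence every nontrivial negative
path is counted exactly twice in `coeff`, which explains the factor one half there. -/
theorem IsNegativePathBetween.endpoints (hT : T.IsTree) {pos U : Finset V} {p q p' q' : V}
    (h : IsNegativePathBetween T pos p q U) (h' : IsNegativePathBetween T pos p' q' U) :
    (p' = p ∧ q' = q) ∨ (p' = q ∧ q' = p) := by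
  have h1 := h'.2.2.1 p h.1
  have h2 := h'.2.2.1 q h.2.1
  have h3 := h.2.2.1 p' h'.1
  have h4 := h.2.2.1 q' h'.2.1
  have h5 := pathSet_subset_union hT p h2
  have e := fun a b => hT.connected.dist_eq_zero_iff (u := a) (v := b)
  have c := fun a b => T.dist_comm (u := a) (v := b)
  have t := fun a b d => hT.connected.dist_triangle (u := a) (v := b) (w := d)
  simp only [mem_pathSet_iff_dist hT] at h1 h2 h3 h4 h5
  have t1 := t p p' q
  have t2 := t p' q' q
  have t3 := t p q' q
  have t4 := t q' p' q
  have := c p p'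
  have := c q q'
  have := c p q
  have := c p' q'
  have := c p q'
  have := c p' q
  rcases h5 with h5 | h5
  · exact Or.inr ⟨(e _ _).1 (by omega), (e _ _).1 (by omega)⟩
  · exact Or.inl ⟨(e _ _).1 (by omega), (e _ _).1 (by omega)⟩

theorem isNegativePathBetween_singleton (hT : T.IsTree) (pos : Finset V) (p : V) :
    IsNegativePathBetween T pos p p {p} := by
  simp [IsNegativePathBetween, mem_pathSet_self hT]

theorem IsNegativePathBetween.eq_singleton (hT : T.IsTree) {pos U : Finset V} {p : V}
    (h : IsNegativePathBetween T pos p p U) : U = {p} := by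
  ext u
  rw [Finset.mem_singleton]
  exact ⟨fun hu => (mem_pathSet_self hT).1 (h.2.2.1 u hu), by rintro rfl; exact h.1⟩

theorem weight_comm {pos U : Finset V} (p q : V) : weight T pos p q U = weight T pos q p U := by
  by_cases h : p = q
  · rw [h]
  · rw [weight, weight, if_neg h, if_neg (Ne.symm h), mul_comm (omega T pos p q)]

/-- The coefficients of the decomposition of the signed tree associahedron, as a sum over
possible endpoints. -/
noncomputable def coeff (T : SimpleGraph V) (pos U : Finset V) : ℝ :=
  (∑ p, if U = {p} then (1 - (if p ∈ pos then (numSeparated T p : ℝ) else 0) / 2) else 0) +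
  (∑ x : V × V, if x.1 ≠ x.2 ∧ IsNegativePathBetween T pos x.1 x.2 U then
    weight T pos x.1 x.2 U else 0) / 2

theorem coeff_of_not_isNegativePath (hT : T.IsTree) {pos U : Finset V}
    (h : ¬ IsNegativePath T pos U) : coeff T pos U = 0 := by
  rw [coeff, Finset.sum_eq_zero, Finset.sum_eq_zero]
  · simp
  · exact fun x _ => if_neg fun hx => h ⟨_, _, hx.2⟩
  · refine fun p _ => if_neg fun hp => h ⟨p, p, by rw [hp]; exact isNegativePathBetween_singleton hT pos p⟩

theorem coeff_singleton (pos : Finset V) (p : V) :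
    coeff T pos {p} = 1 - (if p ∈ pos then (numSeparated T p : ℝ) else 0) / 2 := by
  rw [coeff, Finset.sum_eq_zero (s := (Finset.univ : Finset (V × V))), Finset.sum_eq_single p]
  · simp
  · exact fun b _ hb => if_neg (by simpa using hb.symm)
  · simp
  · intro x _
    refine if_neg fun hx => hx.1 ?_
    have h1 := Finset.mem_singleton.1 hx.2.1
    have h2 := Finset.mem_singleton.1 hx.2.2.1
    rw [h1, h2]

/-- The term $\nu \deg(v)/2$ of the statement cancels the same term in $-\tilde\omega(v)$, leaving
$1$ minus half the number of separated pairs. -/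
theorem coeff_singleton_of_mem [DecidableRel T.Adj] (hT : T.IsTree) {pos : Finset V} {p : V}
    (hp : p ∈ pos) : coeff T pos {p} =
      weight T pos p p {p} + (Fintype.card V : ℝ) * (T.degree p : ℝ) / 2 + 1 := by
  have h := two_mul_omegaTilde hT hp
  rw [Set.ncard_eq_toFinset_card', Set.toFinset_card, T.card_neighborSet_eq_degree] at h
  rw [coeff_singleton, weight, if_pos rfl, if_pos hp, Finset.singleton_inter_of_mem hp]
  simp only [Finset.card_singleton]
  linarith

theorem coeff_singleton_of_notMem {pos : Finset V} {p : V}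
    (hp : p ∉ pos) : coeff T pos {p} = weight T pos p p {p} := by
  rw [coeff_singleton, weight, if_pos rfl, if_neg hp, Finset.singleton_inter_of_notMem hp,
    omegaTilde, if_neg hp]
  simp

theorem coeff_of_isNegativePathBetween (hT : T.IsTree) {pos U : Finset V} {p q : V}
    (hpq : p ≠ q) (h : IsNegativePathBetween T pos p q U) :
    coeff T pos U = weight T pos p q U := by
  rw [coeff, Finset.sum_eq_zero, Fintype.sum_eq_add (p, q) (q, p)]
  · rw [if_pos ⟨hpq, h⟩, if_pos ⟨hpq.symm, h.symm hT⟩, weight_comm q p]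
    ring
  · simp [hpq]
  · rintro ⟨a, b⟩ ⟨h1, h2⟩
    refine if_neg fun hx => ?_
    rcases h.endpoints hT hx.2 with ⟨ha, hb⟩ | ⟨ha, hb⟩
    · exact h1 (Prod.ext ha hb)
    · exact h2 (Prod.ext ha hb)
  · intro r _
    refine if_neg fun hr => hpq ?_
    have h1 := h.1
    have h2 := h.2.1
    rw [hr, Finset.mem_singleton] at h1 h2
    rw [h1, h2]

theorem eq_coeff_iff [DecidableRel T.Adj] (hT : T.IsTree) (pos : Finset V) (y : Finset V → ℝ)
    (U : Finset V) :
    ((¬ IsNegativePath T pos U → y U = 0) ∧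
      (∀ v ∈ pos, U = {v} →
        y U = weight T pos v v U + (Fintype.card V : ℝ) * (T.degree v : ℝ) / 2 + 1) ∧
      (∀ p q : V, IsNegativePathBetween T pos p q U → (¬ ∃ v ∈ pos, U = {v}) →
        y U = weight T pos p q U)) ↔ y U = coeff T pos U := by
  constructor
  · rintro ⟨h1, h2, h3⟩
    by_cases hU : IsNegativePath T pos U
    · obtain ⟨p, q, h⟩ := hU
      by_cases hpq : p = q
      · subst hpq
        obtain rfl := h.eq_singleton hT
        by_cases hp : p ∈ pos
        · rw [h2 p hp rfl, coeff_singleton_of_mem hT hp]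
        · rw [h3 p p h (by rintro ⟨v, hv, hpv⟩; exact hp (Finset.singleton_inj.1 hpv ▸ hv)),
            coeff_singleton_of_notMem hp]
      · rw [coeff_of_isNegativePathBetween hT hpq h]
        refine h3 p q h ?_
        rintro ⟨v, -, rfl⟩
        have h1 := Finset.mem_singleton.1 h.1
        have h2 := Finset.mem_singleton.1 h.2.1
        exact hpq (h1.trans h2.symm)
    · rw [h1 hU, coeff_of_not_isNegativePath hT hU]
  · intro h
    rw [h]
    refine ⟨coeff_of_not_isNegativePath hT, ?_, ?_⟩
    · rintro v hv rfl
      exact coeff_singleton_of_mem hT hv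
    · intro p q hU hv
      by_cases hpq : p = q
      · subst hpq
        obtain rfl := hU.eq_singleton hT
        exact coeff_singleton_of_notMem fun hp => hv ⟨p, hp, rfl⟩
      · exact coeff_of_isNegativePathBetween hT hpq hU

/-- The negative paths inside `R` are the sets `N ∪ Y` with `Y ⊆ X`, where `N` is forced and `X`
holds the optional positive vertices. The alternating sum over `Y` vanishes unless `X` is empty. -/
theorem sum_weight_negativePaths (hT : T.IsTree) (pos R : Finset V) {p q : V} (hpq : p ≠ q) :
    (∑ U ∈ R.powerset, if IsNegativePathBetween T pos p q U then weight T pos p q U else 0) =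
      if Sees T pos R p q then
        ((shadow T pos p q).card : ℝ) * ((shadow T pos q p).card : ℝ) else 0 := by
  let N : Finset V := Finset.univ.filter
    fun w => w = p ∨ w = q ∨ (w ∈ pathSet T p q ∧ w ∉ pos)
  let X : Finset V := Finset.univ.filter
    fun w => w ∈ R ∧ w ∈ pos ∧ w ∈ pathSet T p q ∧ w ≠ p ∧ w ≠ q
  have hNp : N ∩ pos = ({p, q} : Finset V) ∩ pos := by
    ext w
    simp only [N, Finset.mem_inter, Finset.mem_filter, Finset.mem_univ, true_and,
      Finset.mem_insert, Finset.mem_singleton]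
    tauto
  by_cases hN : N ⊆ R
  · have hval : ∀ Y ∈ X.powerset, weight T pos p q (N ∪ Y) = (-1) ^ Y.card *
        (((shadow T pos p q).card : ℝ) * ((shadow T pos q p).card : ℝ)) := by
      intro Y hY
      rw [Finset.mem_powerset] at hY
      have h1 : (N ∪ Y) ∩ pos = (({p, q} : Finset V) ∩ pos) ∪ Y := by
        rw [Finset.union_inter_distrib_right, hNp]
        congr 1
        exact Finset.inter_eq_left.2 fun w hw => (Finset.mem_filter.1 (hY hw)).2.2.1
      have h2 : Disjoint (({p, q} : Finset V) ∩ pos) Y := by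
        rw [Finset.disjoint_left]
        intro w hw hwY
        have := (Finset.mem_filter.1 (hY hwY)).2
        simp only [Finset.mem_inter, Finset.mem_insert, Finset.mem_singleton] at hw
        tauto
      rw [weight, if_neg hpq, h1, Finset.card_union_of_disjoint h2, pow_add]
      -- Each endpoint contributes one sign, through $(-1)^{|P^+|}$ if positive and through $\omega
      -- = -1$ if negative, and the two signs cancel.
      by_cases hp : p ∈ pos <;> by_cases hq : q ∈ pos
      · rw [omega_of_mem hT hp hpq, omega_of_mem hT hq hpq.symm]
        simp [Finset.insert_inter_of_mem, hp, hq, Finset.card_pair hpq]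
      · rw [omega_of_mem hT hp hpq, omega_of_notMem hq]
        simp [Finset.insert_inter_of_mem, hp, hq]
      · rw [omega_of_notMem hp, omega_of_mem hT hq hpq.symm]
        simp [Finset.insert_inter_of_notMem, hp, hq]
      · rw [omega_of_notMem hp, omega_of_notMem hq]
        simp [Finset.insert_inter_of_notMem, hp, hq]
    have hmem : ∀ U, U ∈ R.powerset.filter (fun U => IsNegativePathBetween T pos p q U) ↔
        N ⊆ U ∧ U ⊆ N ∪ X := by
      intro U
      rw [Finset.mem_filter, Finset.mem_powerset]
      constructor
      · rintro ⟨hU, h1, h2, h3, h4⟩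
        constructor
        · intro w hw
          rcases (Finset.mem_filter.1 hw).2 with rfl | rfl | ⟨h5, h6⟩
          exacts [h1, h2, h4 w h5 h6]
        · intro w hw
          have h5 := h3 w hw
          have h6 := hU hw
          simp only [N, X, Finset.mem_union, Finset.mem_filter, Finset.mem_univ, true_and]
          tauto
      · rintro ⟨h1, h2⟩
        refine ⟨fun w hw => ?_, h1 (by simp [N]), h1 (by simp [N]), fun w hw => ?_,
          fun w hw hwp => h1 (by simp [N, hw, hwp])⟩
        · rcases Finset.mem_union.1 (h2 hw) with h | h
          exacts [hN h, (Finset.mem_filter.1 h).2.1]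
        · have := h2 hw
          simp only [N, X, Finset.mem_union, Finset.mem_filter, Finset.mem_univ, true_and] at this
          rcases this with (rfl | rfl | h) | h
          exacts [left_mem_pathSet hT _ _, right_mem_pathSet hT _ _, h.1, h.2.2.1]
    have hdisj : Disjoint N X := by
      rw [Finset.disjoint_left]
      intro w hw hwX
      have h1 := (Finset.mem_filter.1 hw).2
      have h2 := (Finset.mem_filter.1 hwX).2
      tauto
    have hsum : ∑ U ∈ R.powerset with IsNegativePathBetween T pos p q U, weight T pos p q U =
        ∑ Y ∈ X.powerset, weight T pos p q (N ∪ Y) := by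
      symm
      refine Finset.sum_nbij' (fun Y => N ∪ Y) (fun U => U \ N) ?_ ?_ ?_ ?_ fun _ _ => rfl
      · intro Y hY
        rw [hmem]
        exact ⟨Finset.subset_union_left,
          Finset.union_subset_union_right (Finset.mem_powerset.1 hY)⟩
      · intro U hU
        rw [hmem] at hU
        rw [Finset.mem_powerset]
        exact sdiff_le_iff.2 hU.2
      · intro Y hY
        exact Finset.union_sdiff_cancel_left
          (hdisj.mono_right (Finset.mem_powerset.1 hY))
      · intro U hU
        rw [hmem] at hU
        exact Finset.union_sdiff_of_subset hU.1
    have hsees : Sees T pos R p q ↔ X = ∅ := by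
      rw [Finset.eq_empty_iff_forall_notMem]
      constructor
      · rintro ⟨-, -, -, h⟩ w hw
        obtain ⟨-, h1, h2, h3, h4, h5⟩ := Finset.mem_filter.1 hw
        exact (h w h3 h4 h5).1 h2 h1
      · intro h
        refine ⟨hN (by simp [N]), hN (by simp [N]), hpq, fun z hz h1 h2 => ⟨fun hp hR => ?_, ?_⟩⟩
        · exact h z (by simp [X, hz, h1, h2, hp, hR])
        · intro hR
          by_contra hp
          exact hR (hN (by simp [N, hz, hp]))
    rw [← Finset.sum_filter, hsum, Finset.sum_congr rfl hval, ← Finset.sum_mul]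
    have := congrArg (Int.cast : ℤ → ℝ) (Finset.sum_powerset_neg_one_pow_card (x := X))
    push_cast at this
    rw [this, hsees]
    split_ifs <;> simp
  · rw [if_neg, Finset.sum_eq_zero]
    · intro U hU
      rw [Finset.mem_powerset] at hU
      refine if_neg fun h => hN fun w hw => hU ?_
      rcases (Finset.mem_filter.1 hw).2 with rfl | rfl | ⟨h5, h6⟩
      exacts [h.1, h.2.1, h.2.2.2 w h5 h6]
    · rintro ⟨h1, h2, -, h3⟩
      refine hN fun w hw => ?_
      rcases (Finset.mem_filter.1 hw).2 with rfl | rfl | ⟨h5, h6⟩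
      · exact h1
      · exact h2
      · by_cases hp : w = p
        · exact hp ▸ h1
        · by_cases hq : w = q
          · exact hq ▸ h2
          · by_contra hR
            exact h6 ((h3 w h5 hp hq).2 hR)

theorem sum_coeff (hT : T.IsTree) (pos R : Finset V) :
    ∑ U ∈ R.powerset, coeff T pos U = (twiceRank T pos R : ℝ) / 2 := by
  have h1 : (∑ U ∈ R.powerset, ∑ p, if U = {p} then
      (1 - (if p ∈ pos then (numSeparated T p : ℝ) else 0) / 2) else 0) =
      ∑ p ∈ R, (1 - (if p ∈ pos then (numSeparated T p : ℝ) else 0) / 2) := by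
    rw [Finset.sum_comm, ← Finset.sum_subset (Finset.subset_univ R)]
    · refine Finset.sum_congr rfl fun p hp => ?_
      rw [Finset.sum_ite_eq', if_pos (by simpa using hp)]
    · intro p _ hp
      rw [Finset.sum_ite_eq', if_neg (by simpa using hp)]
  have h2 : (∑ U ∈ R.powerset, ∑ x : V × V,
      if x.1 ≠ x.2 ∧ IsNegativePathBetween T pos x.1 x.2 U then weight T pos x.1 x.2 U else 0) =
      ∑ p, ∑ q, if Sees T pos R p q then
        ((shadow T pos p q).card : ℝ) * ((shadow T pos q p).card : ℝ) else 0 := by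
    rw [Finset.sum_comm, Fintype.sum_prod_type]
    refine Finset.sum_congr rfl fun p _ => Finset.sum_congr rfl fun q _ => ?_
    by_cases hpq : p = q
    · subst hpq
      have : ¬ Sees T pos R p p := fun h => h.2.2.1 rfl
      simp [this]
    · simp only [ne_eq, hpq, not_false_eq_true, true_and]
      exact sum_weight_negativePaths hT pos R hpq
  simp only [coeff, Finset.sum_add_distrib, ← Finset.sum_div, h1, h2, twiceRank]
  push_cast
  rw [add_div, add_comm]
  congr 1
  rw [Finset.sum_div]
  refine Finset.sum_congr rfl fun p _ => ?_
  ring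

/-! ### Base polytope description and conclusion -/

theorem mem_asso_iff (hT : T.IsTree) (pos : Finset V) (x : V → ℝ) :
    x ∈ asso T pos ↔ (∀ R, (twiceRank T pos R : ℝ) / 2 ≤ ∑ v ∈ R, x v) ∧
      ∑ v, x v = (twiceRank T pos Finset.univ : ℝ) / 2 := by
  constructor
  · intro hx
    refine ⟨fun R => by linarith [twiceRank_le hT hx R], ?_⟩
    rw [hx.1, cast_choose_succ_two, twiceRank_univ hT]
    push_cast
    ring
  · rintro ⟨h1, h2⟩
    exact mem_asso_of_twiceRank_le hT (fun R => by linarith [h1 R]) (by linarith)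

theorem isMinkowskiDecomposition_coeff (hT : T.IsTree) (pos : Finset V) :
    IsMinkowskiDecomposition (asso T pos) (coeff T pos) := by
  have := hT.connected.nonempty
  refine isMinkowskiDecomposition_of_supermodular (mem_asso_iff hT pos) (fun R S => ?_) ?_
    (sum_coeff hT pos)
  · have : ((twiceRank T pos R + twiceRank T pos S : ℤ) : ℝ) ≤
        ((twiceRank T pos (R ∩ S) + twiceRank T pos (R ∪ S) : ℤ) : ℝ) :=
      Int.cast_le.2 (twiceRank_supermodular hT pos R S)
    push_cast at this
    linarith
  · refine coeff_of_not_isNegativePath hT ?_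
    rintro ⟨p, q, h, -⟩
    simp at h

end SignedTree

theorem proposition98 {V : Type*} [Fintype V] [DecidableEq V] (T : SimpleGraph V)
    [DecidableRel T.Adj] (hT : T.IsTree) (pos : Finset V) (y : Finset V → ℝ) :
    SignedTree.IsMinkowskiDecomposition (SignedTree.asso T pos) y ↔
      ∀ U : Finset V,
        (¬ SignedTree.IsNegativePath T pos U → y U = 0) ∧
        (∀ v ∈ pos, U = {v} →
          y U = SignedTree.weight T pos v v U + (Fintype.card V : ℝ) * (T.degree v : ℝ) / 2 + 1) ∧
        (∀ p q : V, SignedTree.IsNegativePathBetween T pos p q U → (¬ ∃ v ∈ pos, U = {v}) →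
          y U = SignedTree.weight T pos p q U) := by
  have h := SignedTree.isMinkowskiDecomposition_coeff hT pos
  simp only [SignedTree.eq_coeff_iff hT]
  constructor
  · intro hy U
    rw [hy.unique h]
  · intro hy
    rwa [funext hy]
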